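/- Linear strain-gradient elasticity in Cartesian coordinates of $\mathbb{R}^3$ (summation over repeated indices, commas denote partial derivatives). A material is a triple of constant tensors $\mathsf{C}_{ijlm}=\mathsf{C}_{jilm}=\mathsf{C}_{lmij}$, $\mathsf{M}_{ijklm}=\mathsf{M}_{jiklm}=\mathsf{M}_{ijlkm}$, $\mathsf{A}_{ijklmn}=\mathsf{A}_{jiklmn}=\mathsf{A}_{lmnijk}$. With $e_{lm}=\frac12(u_{l,m}+u_{m,l})$, the stresses are $\sigma_{ik}=\mathsf{C}_{iklm}e_{lm}+\mathsf{M}_{iklmn}e_{lm,n}$ and $\tau_{ijk}=\mathsf{M}_{lmijk}e_{lm}+\mathsf{A}_{ijklmn}e_{lm,n}$, and equilibrium without body forces is $\sigma_{ik,i}-\tau_{ijk,ij}=0$. For a subgroup $G\subset O(3)$, the materials of class $G$ are those whose three tensors are all invariant under $G$. Let $\mathbb{T}$ be the tetrahedral rotation group generated by the rotation by $\pi$ about the $x_3$-axis and the rotation by $2\pi/3$ about $(1,1,1)$, and let $\mathbb{T}\oplus\mathbb{Z}_2^c$ be generated by $\mathbb{T}$ and $-I$. Let $\Omega\subset\mathbb{R}^3$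 be open, connected and non-empty. A displacement field $u$ on $\Omega$ is universal for the class $G$ if it is of class $C^4$ on $\Omega$ and satisfies the equilibrium equations on $\Omega$ for every material of class $G$. (i) A field $u$ is universal for the class $\mathbb{T}$ if and only if there are constants $a,a_1,b_1,c_1,d_1,d_2,d_3$, harmonic functions $g_1,g_2,g_3$ on $\mathbb{R}^2$, and $C^4$ functions $f_1,\dots,f_{12}:\mathbb{R}\to\mathbb{R}$ such that on $\Omega$ $$\begin{aligned}u_1&=\tfrac a2x_1(x_3^2-x_2^2)+c_1x_1x_3+b_1x_1x_2+d_1x_1+g_1(x_2,x_3),\\ u_2&=\tfrac a2x_2(x_1^2-x_3^2)+a_1x_1x_2-c_1x_2x_3+d_2x_2+g_2(x_1,x_3),\\ u_3&=\tfrac a2x_3(x_2^2-x_1^2)-a_1x_1x_3-b_1x_2x_3+d_3x_3+g_3(x_1,x_2),\end{aligned}$$ and, for all real values of the variables, the splitting conditions $$\begin{aligned}&g_1(x_2,x_3)=f_1(x_3)+x_2f_2(x_3)+f_3(x_2)+x_3f_4(x_2),\quad f_3''''(x_2)+x_3f_4''''(x_2)=0,\quad f_1''''(x_3)+x_2f_2''''(x_3)=0,\\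 &g_2(x_1,x_3)=f_5(x_3)+x_1f_6(x_3)+f_7(x_1)+x_3f_8(x_1),\quad f_7''''(x_1)+x_3f_8''''(x_1)=0,\quad f_5''''(x_3)+x_1f_6''''(x_3)=0,\\ &g_3(x_1,x_2)=f_9(x_2)+x_1f_{10}(x_2)+f_{11}(x_1)+x_2f_{12}(x_1),\quad f_{11}''''(x_1)+x_2f_{12}''''(x_1)=0,\quad f_9''''(x_2)+x_1f_{10}''''(x_2)=0\end{aligned}$$ hold together with $$\begin{aligned}&f_4''(x_2)=0,\quad f_2''(x_3)=0,\quad f_3'''(x_2)+x_3f_4'''(x_2)=0,\quad f_1'''(x_3)+x_2f_2'''(x_3)=0,\\ &f_8''(x_1)=0,\quad f_6''(x_3)=0,\quad f_7'''(x_1)+x_3f_8'''(x_1)=0,\quad f_5'''(x_3)+x_1f_6'''(x_3)=0,\\ &f_{12}''(x_1)=0,\quad f_{10}''(x_2)=0,\quad f_{11}'''(x_1)+x_2f_{12}'''(x_1)=0,\quad f_9'''(x_2)+x_1f_{10}'''(x_2)=0.\end{aligned}$$ (ii) A field $u$ is universal for the class $\mathbb{T}\oplus\mathbb{Z}_2^c$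 if and only if it has the displayed form on $\Omega$ with constants $a,a_1,b_1,c_1,d_1,d_2,d_3$, harmonic functions $g_1,g_2,g_3$ on $\mathbb{R}^2$ and $C^4$ functions $f_1,\dots,f_{12}$ that satisfy the splitting conditions (without the second- and third-derivative conditions). -/

import Mathlib

open scoped BigOperators

noncomputable section

namespace StrainGradient

/-- Three-dimensional space with Cartesian coordinates `x 0, x 1, x 2` (these are x₁, x₂, x₃). -/
abbrev E3 := EuclideanSpace ℝ (Fin 3)

/-- The Euclidean plane. -/
abbrev E2 := EuclideanSpace ℝ (Fin 2)

/-- The orthogonal group O(3). -/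
abbrev O3 := Matrix.orthogonalGroup (Fin 3) ℝ

/-- The partial derivative `∂f/∂xᵢ`. -/
def pd (i : Fin 3) (f : E3 → ℝ) (x : E3) : ℝ :=
  fderiv ℝ f x (EuclideanSpace.single i 1)

/-- The constant elasticity tensors of a linear strain-gradient elastic solid, with their index
symmetries. -/
structure Moduli where
  C : Fin 3 → Fin 3 → Fin 3 → Fin 3 → ℝ
  M : Fin 3 → Fin 3 → Fin 3 → Fin 3 → Fin 3 → ℝ
  A : Fin 3 → Fin 3 → Fin 3 → Fin 3 → Fin 3 → Fin 3 → ℝ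
  C_minor : ∀ i j l m, C i j l m = C j i l m
  C_major : ∀ i j l m, C i j l m = C l m i j
  M_minor_left : ∀ i j k l m, M i j k l m = M j i k l m
  M_minor_right : ∀ i j k l m, M i j k l m = M i j l k m
  A_minor : ∀ i j k l m n, A i j k l m n = A j i k l m n
  A_major : ∀ i j k l m n, A i j k l m n = A l m n i j k

namespace Moduli

variable (L : Moduli)

/-- The symmetry group of the fourth-order tensor. -/
def symC : Set O3 :=
  {Q | ∀ i j k l, ∑ o, ∑ p, ∑ q, ∑ r,
    Q.1 i o * Q.1 j p * Q.1 k q * Q.1 l r * L.C o p q r = L.C i j k l}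

/-- The symmetry group of the fifth-order tensor. -/
def symM : Set O3 :=
  {Q | ∀ i j k l m, ∑ o, ∑ p, ∑ q, ∑ r, ∑ s,
    Q.1 i o * Q.1 j p * Q.1 k q * Q.1 l r * Q.1 m s * L.M o p q r s = L.M i j k l m}

/-- The symmetry group of the sixth-order tensor. -/
def symA : Set O3 :=
  {Q | ∀ i j k l m n, ∑ o, ∑ p, ∑ q, ∑ r, ∑ s, ∑ t,
    Q.1 i o * Q.1 j p * Q.1 k q * Q.1 l r * Q.1 m s * Q.1 n t * L.A o p q r s t
      = L.A i j k l m n}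

/-- The symmetry group of the solid. -/
def sym : Set O3 := L.symA ∩ L.symM ∩ L.symC

end Moduli

/-- The linearized strain `e_{lm} = (u_{l,m} + u_{m,l}) / 2`. -/
def strain (u : E3 → E3) (l m : Fin 3) (x : E3) : ℝ :=
  (pd m (fun y => u y l) x + pd l (fun y => u y m) x) / 2

/-- The Cauchy stress `σ_{ik} = C_{iklm} e_{lm} + M_{iklmn} e_{lm,n}`. -/
def stress (L : Moduli) (u : E3 → E3) (i k : Fin 3) (x : E3) : ℝ :=
  (∑ l, ∑ m, L.C i k l m * strain u l m x)
    + ∑ l, ∑ m, ∑ n, L.M i k l m n * pd n (strain u l m) x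

/-- The hyper-stress `τ_{ijk} = M_{lmijk} e_{lm} + A_{ijklmn} e_{lm,n}`. -/
def hyperStress (L : Moduli) (u : E3 → E3) (i j k : Fin 3) (x : E3) : ℝ :=
  (∑ l, ∑ m, L.M l m i j k * strain u l m x)
    + ∑ l, ∑ m, ∑ n, L.A i j k l m n * pd n (strain u l m) x

/-- The equilibrium equations without body forces, `σ_{ik,i} - τ_{ijk,ij} = 0`, at the point `x`. -/
def EquilibriumAt (L : Moduli) (u : E3 → E3) (x : E3) : Prop :=
  ∀ k, (∑ i, pd i (stress L u i k) x)
    - ∑ i, ∑ j, pd j (pd i (hyperStress L u i j k)) x = 0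

/-- `u` is a universal displacement on `Ω` for the material class of the group `G`: it is in
equilibrium, without body forces, for all moduli that are invariant under `G`. -/
def IsUniversalDisplacement (G : Subgroup O3) (Ω : Set E3) (u : E3 → E3) : Prop :=
  ContDiffOn ℝ 4 u Ω ∧
    ∀ L : Moduli, (G : Set O3) ⊆ L.sym → ∀ x ∈ Ω, EquilibriumAt L u x

/-- The rotation by the angle `π` about the `x₃`-axis. -/
def halfTurn : O3 :=
  ⟨!![-1, 0, 0; 0, -1, 0; 0, 0, 1], by
    rw [Matrix.mem_orthogonalGroup_iff]
    ext i j
    fin_cases i <;> fin_cases j <;> simp [Matrix.mul_apply, Fin.sum_univ_three]⟩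

/-- The rotation by the angle `2π/3` about the axis `(1, 1, 1)`: `e₁ ↦ e₂ ↦ e₃ ↦ e₁`. -/
def thirdTurn : O3 :=
  ⟨!![0, 0, 1; 1, 0, 0; 0, 1, 0], by
    rw [Matrix.mem_orthogonalGroup_iff]
    ext i j
    fin_cases i <;> fin_cases j <;> simp [Matrix.mul_apply, Fin.sum_univ_three]⟩

/-- The tetrahedral rotation group `𝕋` (of order 12). -/
def groupT : Subgroup O3 := Subgroup.closure {halfTurn, thirdTurn}

/-- The group `𝕋 ⊕ ℤ₂ᶜ`, generated by `𝕋` and the inversion `-1`. -/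
def groupTZ2c : Subgroup O3 := groupT ⊔ Subgroup.closure {-1}

/-- The universal displacement fields of classical linear elasticity for the cubic class, with
`g₁`, `g₂`, `g₃` harmonic functions of two variables. -/
def HasCubicForm (Ω : Set E3) (u : E3 → E3) (a a₁ b₁ c₁ d₁ d₂ d₃ : ℝ) (g₁ g₂ g₃ : E2 → ℝ) :
    Prop :=
  InnerProductSpace.HarmonicOnNhd g₁ Set.univ ∧
  InnerProductSpace.HarmonicOnNhd g₂ Set.univ ∧
  InnerProductSpace.HarmonicOnNhd g₃ Set.univ ∧
  ∀ x ∈ Ω,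
    u x 0 = a / 2 * x 0 * (x 2 ^ 2 - x 1 ^ 2) + c₁ * x 0 * x 2 + b₁ * x 0 * x 1 + d₁ * x 0
      + g₁ !₂[x 1, x 2] ∧
    u x 1 = a / 2 * x 1 * (x 0 ^ 2 - x 2 ^ 2) + a₁ * x 0 * x 1 - c₁ * x 1 * x 2 + d₂ * x 1
      + g₂ !₂[x 0, x 2] ∧
    u x 2 = a / 2 * x 2 * (x 1 ^ 2 - x 0 ^ 2) - a₁ * x 0 * x 2 - b₁ * x 1 * x 2 + d₃ * x 2
      + g₃ !₂[x 0, x 1]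

/-- The function `g(s, t)` splits as `p(t) + s q(t) + r(s) + t w(s)`, with `r'''' + t w'''' = 0`
and `p'''' + s q'''' = 0`. -/
def Splits (g : E2 → ℝ) (p q r w : ℝ → ℝ) : Prop :=
  ContDiff ℝ 4 p ∧ ContDiff ℝ 4 q ∧ ContDiff ℝ 4 r ∧ ContDiff ℝ 4 w ∧
  (∀ s t : ℝ, g !₂[s, t] = p t + s * q t + r s + t * w s) ∧
  (∀ s t : ℝ, iteratedDeriv 4 r s + t * iteratedDeriv 4 w s = 0) ∧
  (∀ s t : ℝ, iteratedDeriv 4 p t + s * iteratedDeriv 4 q t = 0)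

/-- The second- and third-derivative conditions on the four functions of a splitting:
`w'' = 0`, `q'' = 0`, `r''' + t w''' = 0` and `p''' + s q''' = 0`. -/
def LowerConditions (p q r w : ℝ → ℝ) : Prop :=
  (∀ s : ℝ, iteratedDeriv 2 w s = 0) ∧
  (∀ t : ℝ, iteratedDeriv 2 q t = 0) ∧
  (∀ s t : ℝ, iteratedDeriv 3 r s + t * iteratedDeriv 3 w s = 0) ∧
  (∀ s t : ℝ, iteratedDeriv 3 p t + s * iteratedDeriv 3 q t = 0)

end StrainGradient

end

/-! Testing equilibrium on a few special materials forces the displacement to be a polynomial, and a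
parity count shows that the polynomials so obtained are in equilibrium for every material of the
class.

Necessity. Both groups lie in groups of signed cyclic permutation matrices, so any material
invariant under the latter may be tested. Classical cubic and isotropic materials give, without
summation over `k`, `u_{k,kk} = 0`, `∂_k div u = 0` and `Δu_k = 0`. Consequently the mixed second
derivatives `u_{i,ij}` depend on one variable each, with one common constant slope up to sign, and
`u_{i,i}` is a quadratic polynomial (`IsUniversalDisplacement.exists_pd_self`). Subtracting `x_i`
times it from `u_i` leaves a function of the other two variables that is harmonic in them. A
sixth-order material adds `∂_{k+1}⁴ u_k = 0`, which makes this remainder a `harmonicPoly`. For `𝕋`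
alone, fifth-order materials add `u_{i,jjk} = 0` for distinct indices, which removes its quartic and
cubic terms.

Sufficiency. Give each index its sign under the half-turn about a coordinate axis. If `u_{l,pqrs}`
is not zero, its five signs multiply to `1` for all three axes. An invariant `A` contracted with it
has one further index, whose sign is `-1` for some axis, so that component of `A` vanishes. The same
count disposes of `M` when the remainders are at most quadratic; if `-1` is in the group, `M = 0`
anyway. What is left is `C`, which is cubic with three constants and multiplies only combinations of
`u_{k,kk}`, `∂_k div u` and `Δu_k`.

Finally, a harmonic function satisfying the splitting conditions is a `harmonicPoly`, and every
`harmonicPoly` can be split; the lower conditions correspond to the vanishing of its first three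
coefficients. -/

noncomputable section

namespace StrainGradient

open Set Filter Topology MvPolynomial

/-! ### Calculus of partial derivatives on open sets with limited regularity. -/

section PartialDerivatives

variable {Ω : Set E3} {f g : E3 → ℝ} {x : E3}

theorem pd_eq_of_eqOn (hΩ : IsOpen Ω) (h : EqOn f g Ω) (hx : x ∈ Ω) (i : Fin 3) :
    pd i f x = pd i g x := by
  unfold pd
  rw [(h.eventuallyEq_of_mem (hΩ.mem_nhds hx)).fderiv_eq]

theorem contDiffOn_pd (hΩ : IsOpen Ω) {n m : WithTop ℕ∞} (hf : ContDiffOn ℝ n f Ω) (h : m + 1 ≤ n)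
    (i : Fin 3) : ContDiffOn ℝ m (pd i f) Ω :=
  (hf.fderiv_of_isOpen hΩ h).clm_apply contDiffOn_const

theorem contDiffOn_pd_three (hΩ : IsOpen Ω) (hf : ContDiffOn ℝ 4 f Ω) (i : Fin 3) :
    ContDiffOn ℝ 3 (pd i f) Ω := contDiffOn_pd hΩ hf (by norm_num) i

theorem contDiffOn_pd_two (hΩ : IsOpen Ω) (hf : ContDiffOn ℝ 3 f Ω) (i : Fin 3) :
    ContDiffOn ℝ 2 (pd i f) Ω := contDiffOn_pd hΩ hf (by norm_num) i

theorem contDiffOn_pd_one (hΩ : IsOpen Ω) (hf : ContDiffOn ℝ 2 f Ω) (i : Fin 3) :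
    ContDiffOn ℝ 1 (pd i f) Ω := contDiffOn_pd hΩ hf (by norm_num) i

theorem differentiableAt_of_contDiffOn {n : WithTop ℕ∞} (hΩ : IsOpen Ω) (hf : ContDiffOn ℝ n f Ω)
    (hn : n ≠ 0) (hx : x ∈ Ω) : DifferentiableAt ℝ f x :=
  (hf.contDiffAt (hΩ.mem_nhds hx)).differentiableAt hn

theorem pd_add (hf : DifferentiableAt ℝ f x) (hg : DifferentiableAt ℝ g x) (i : Fin 3) :
    pd i (fun y => f y + g y) x = pd i f x + pd i g x := by
  simp [pd, fderiv_fun_add hf hg]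

theorem pd_sub (hf : DifferentiableAt ℝ f x) (hg : DifferentiableAt ℝ g x) (i : Fin 3) :
    pd i (fun y => f y - g y) x = pd i f x - pd i g x := by
  simp [pd, fderiv_fun_sub hf hg]

theorem pd_const_mul (c : ℝ) (hf : DifferentiableAt ℝ f x) (i : Fin 3) :
    pd i (fun y => c * f y) x = c * pd i f x := by
  simp [pd, fderiv_const_mul hf]

theorem pd_neg (i : Fin 3) : pd i (fun y => -f y) x = -pd i f x := by
  simp [pd, fderiv_fun_neg]

theorem pd_div_const (c : ℝ) (hf : DifferentiableAt ℝ f x) (i : Fin 3) :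
    pd i (fun y => f y / c) x = pd i f x / c := by
  simpa [div_eq_inv_mul] using pd_const_mul c⁻¹ hf i

theorem pd_sum {ι : Type*} (s : Finset ι) {F : ι → E3 → ℝ}
    (hF : ∀ a ∈ s, DifferentiableAt ℝ (F a) x) (i : Fin 3) :
    pd i (fun y => ∑ a ∈ s, F a y) x = ∑ a ∈ s, pd i (F a) x := by
  simp [pd, fderiv_fun_sum hF]

theorem pd_zero (i : Fin 3) : pd i (fun _ => (0 : ℝ)) x = 0 := by
  simp [pd]

theorem pd_eq_zero_of_eqOn_zero (hΩ : IsOpen Ω) (h : ∀ y ∈ Ω, f y = 0) (hx : x ∈ Ω) (i : Fin 3) :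
    pd i f x = 0 :=
  (pd_eq_of_eqOn hΩ (g := fun _ => (0 : ℝ)) h hx i).trans (pd_zero i)

theorem pd_comm (hΩ : IsOpen Ω) (hf : ContDiffOn ℝ 2 f Ω) (hx : x ∈ Ω) (i j : Fin 3) :
    pd i (pd j f) x = pd j (pd i f) x := by
  have hc := hf.contDiffAt (hΩ.mem_nhds hx)
  have hd : DifferentiableAt ℝ (fderiv ℝ f) x :=
    (hc.fderiv_right (m := 1) (by norm_num)).differentiableAt one_ne_zero
  have key : ∀ i j, pd i (pd j f) x
      = fderiv ℝ (fderiv ℝ f) x (EuclideanSpace.single i 1) (EuclideanSpace.single j 1) := by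
    intro i j
    change fderiv ℝ (fun y => fderiv ℝ f y (EuclideanSpace.single j 1)) x _ = _
    rw [fderiv_clm_apply hd (differentiableAt_const _)]
    simp
  rw [key, key]
  exact hc.isSymmSndFDerivAt (by simp) _ _

theorem fderiv_eq_zero_of_pd_eq_zero (h : ∀ i, pd i f x = 0) : fderiv ℝ f x = 0 := by
  ext v
  have hv : v = ∑ i, v i • EuclideanSpace.single i (1 : ℝ) := by
    ext j
    simp [Pi.single_apply]
  rw [hv, map_sum]
  simp only [map_smul]
  exact Finset.sum_eq_zero fun i _ => by simpa [pd] using Or.inr (h i)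

theorem exists_eq_const_of_pd_eq_zero (hΩ : IsOpen Ω) (hc : IsPreconnected Ω)
    (hf : DifferentiableOn ℝ f Ω) (h : ∀ i, ∀ x ∈ Ω, pd i f x = 0) : ∃ c, ∀ x ∈ Ω, f x = c :=
  hΩ.exists_is_const_of_fderiv_eq_zero hc hf fun _ hx => fderiv_eq_zero_of_pd_eq_zero (h · _ hx)

/-- Along a segment in the `n`-th direction inside a ball on which `∂f/∂xₙ = 0`, `f` is constant. -/
theorem eq_of_pd_eq_zero_of_mem_ball {r : ℝ} {n : Fin 3} {y : E3} {t : ℝ}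
    (hf : DifferentiableOn ℝ f (Metric.ball x r)) (h : ∀ z ∈ Metric.ball x r, pd n f z = 0)
    (hy : y ∈ Metric.ball x r) (hyt : y + t • EuclideanSpace.single n 1 ∈ Metric.ball x r) :
    f (y + t • EuclideanSpace.single n 1) = f y := by
  set e : E3 := EuclideanSpace.single n 1
  set s : Set ℝ := (fun τ : ℝ => y + τ • e) ⁻¹' Metric.ball x r
  have hd : ∀ τ, HasDerivAt (fun τ : ℝ => y + τ • e) e τ := fun τ => by
    simpa using ((hasDerivAt_id τ).smul_const e).const_add y
  have hs : IsOpen s := Metric.isOpen_ball.preimage (by fun_prop)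
  have hconv : Convex ℝ s := by
    have : s = (AffineMap.lineMap y (y + e) : ℝ →ᵃ[ℝ] E3) ⁻¹' Metric.ball x r := by
      ext τ; simp [s, AffineMap.lineMap_apply, add_comm]
    rw [this]
    exact (convex_ball x r).affine_preimage _
  have hder : ∀ τ ∈ s, HasDerivAt (fun τ : ℝ => f (y + τ • e)) 0 τ := by
    intro τ hτ
    have h1 := ((hf _ hτ).differentiableAt (Metric.isOpen_ball.mem_nhds hτ)).hasFDerivAt
    have h2 := h1.comp_hasDerivAt τ (hd τ)
    rwa [show fderiv ℝ f (y + τ • e) e = 0 from h _ hτ] at h2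
  have := hs.is_const_of_deriv_eq_zero hconv.isPreconnected
    (fun τ hτ => (hder τ hτ).differentiableAt.differentiableWithinAt)
    (fun τ hτ => (hder τ hτ).deriv) (x := t) (y := 0) hyt (by simpa [s] using hy)
  simpa using this

/-- Invariance of `f` under the translation holds on a neighbourhood of `y`, so it passes to the
derivative. No second derivative of `f` is needed. -/
theorem pd_eq_of_pd_eq_zero_of_mem_ball {r : ℝ} {n k : Fin 3} {y : E3} {t : ℝ}
    (hf : DifferentiableOn ℝ f (Metric.ball x r)) (h : ∀ z ∈ Metric.ball x r, pd n f z = 0)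
    (hy : y ∈ Metric.ball x r) (hyt : y + t • EuclideanSpace.single n 1 ∈ Metric.ball x r) :
    pd k f (y + t • EuclideanSpace.single n 1) = pd k f y := by
  have h1 : (fun z => f (z + t • EuclideanSpace.single n 1)) =ᶠ[𝓝 y] f := by
    have hcont : Continuous fun z : E3 => z + t • (EuclideanSpace.single n 1 : E3) :=
      continuous_id.add continuous_const
    filter_upwards [Metric.isOpen_ball.mem_nhds hy,
      hcont.continuousAt.preimage_mem_nhds (Metric.isOpen_ball.mem_nhds hyt)] with z hz hzt
    exact eq_of_pd_eq_zero_of_mem_ball hf h hz hzt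
  unfold pd
  rw [← h1.fderiv_eq, fderiv_comp_add_right]

/-- A mixed second derivative is constant if all the other second derivatives vanish. -/
theorem exists_pd_pd_eq_const (hΩ : IsOpen Ω) (hc : IsPreconnected Ω) (hf : ContDiffOn ℝ 2 f Ω)
    {i j k : Fin 3} (hijk : ∀ n, n = i ∨ n = j ∨ n = k) (hi : ∀ y ∈ Ω, pd i f y = 0)
    (hj : ∀ y ∈ Ω, pd j (pd j f) y = 0) (hk : ∀ y ∈ Ω, pd k (pd k f) y = 0) :
    ∃ c, ∀ y ∈ Ω, pd k (pd j f) y = c := by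
  -- For `f` of class `C²` the mixed derivative is only known to be continuous, so its gradient is
  -- not available. Local constancy comes instead from invariance under small translations along
  -- each axis.
  have hloc : ∀ x ∈ Ω, pd k (pd j f) =ᶠ[𝓝 x] fun _ => pd k (pd j f) x := by
    intro x hx
    obtain ⟨r, hr, hball⟩ := Metric.isOpen_iff.1 hΩ x hx
    have hstep : ∀ (n : Fin 3) (y : E3) (t : ℝ), y ∈ Metric.ball x r →
        y + t • (EuclideanSpace.single n 1 : E3) ∈ Metric.ball x r →
        pd k (pd j f) (y + t • (EuclideanSpace.single n 1 : E3)) = pd k (pd j f) y := by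
      have hd : ∀ n, DifferentiableOn ℝ (pd n f) (Metric.ball x r) := fun n =>
        ((contDiffOn_pd_one hΩ hf n).differentiableOn one_ne_zero).mono hball
      intro n y t hy hyt
      rcases hijk n with rfl | rfl | rfl
      · refine pd_eq_of_pd_eq_zero_of_mem_ball (hd j) (fun z hz => ?_) hy hyt
        rw [pd_comm hΩ hf (hball hz)]
        exact pd_eq_zero_of_eqOn_zero hΩ hi (hball hz) j
      · exact pd_eq_of_pd_eq_zero_of_mem_ball (hd n) (fun z hz => hj z (hball hz)) hy hyt
      · rw [pd_comm hΩ hf (hball hy), pd_comm hΩ hf (hball hyt)]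
        exact pd_eq_of_pd_eq_zero_of_mem_ball (hd n) (fun z hz => hk z (hball hz)) hy hyt
    filter_upwards [Metric.ball_mem_nhds x hr] with y hy
    -- This keeps the corners of the axis-parallel path from `x` to `y` inside the ball.
    have hmem : ∀ v : E3, (∀ n, |v n| ≤ |(y - x) n|) → x + v ∈ Metric.ball x r := by
      intro v hv
      rw [mem_ball_iff_norm, add_sub_cancel_left]
      refine lt_of_le_of_lt ?_ (mem_ball_iff_norm.1 hy)
      rw [EuclideanSpace.norm_eq, EuclideanSpace.norm_eq]
      exact Real.sqrt_le_sqrt (Finset.sum_le_sum fun n _ => by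
        simpa [Real.norm_eq_abs] using sq_le_sq.2 (by simpa using hv n))
    set e : Fin 3 → E3 := fun n => EuclideanSpace.single n 1
    have hy' : y = ((x + (y 0 - x 0) • e 0) + (y 1 - x 1) • e 1) + (y 2 - x 2) • e 2 := by
      ext n
      fin_cases n <;> simp [e]
    have h1 : x + (y 0 - x 0) • e 0 ∈ Metric.ball x r :=
      hmem _ fun n => by fin_cases n <;> simp [e]
    have h2 : x + (y 0 - x 0) • e 0 + (y 1 - x 1) • e 1 ∈ Metric.ball x r := by
      rw [add_assoc]
      exact hmem _ fun n => by fin_cases n <;> simp [e]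
    have h3 : x + (y 0 - x 0) • e 0 + (y 1 - x 1) • e 1 + (y 2 - x 2) • e 2 ∈ Metric.ball x r :=
      hy' ▸ hy
    rw [hy', hstep 2 _ _ h2 h3, hstep 1 _ _ h1 h2, hstep 0 _ _ (Metric.mem_ball_self hr) h1]
  refine exists_eq_const_of_pd_eq_zero hΩ hc (fun x hx => ?_) fun n x hx => ?_
  · exact ((differentiableAt_const _).congr_of_eventuallyEq (hloc x hx)).differentiableWithinAt
  · rw [pd, (hloc x hx).fderiv_eq]
    simp

end PartialDerivatives

/-! ### Equilibrium equations in terms of derivatives of the strain. -/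

section Equilibrium

variable {Ω : Set E3} {u : E3 → E3} {x : E3}

theorem contDiffOn_component {n : WithTop ℕ∞} (hu : ContDiffOn ℝ n u Ω) (l : Fin 3) :
    ContDiffOn ℝ n (fun y => u y l) Ω :=
  (contDiffOn_euclidean.1 hu) l

theorem contDiffOn_strain (hΩ : IsOpen Ω) (hu : ContDiffOn ℝ 4 u Ω) (l m : Fin 3) :
    ContDiffOn ℝ 3 (strain u l m) Ω :=
  ((contDiffOn_pd_three hΩ (contDiffOn_component hu l) m).add
    (contDiffOn_pd_three hΩ (contDiffOn_component hu m) l)).div_const 2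

theorem pd_strain (hΩ : IsOpen Ω) (hu : ContDiffOn ℝ 4 u Ω) (hx : x ∈ Ω) (l m i : Fin 3) :
    pd i (strain u l m) x
      = (pd i (pd m fun y => u y l) x + pd i (pd l fun y => u y m) x) / 2 := by
  have h : ∀ l m, DifferentiableAt ℝ (pd m fun y => u y l) x := fun l m =>
    differentiableAt_of_contDiffOn hΩ (contDiffOn_pd_three hΩ (contDiffOn_component hu l) m)
      (by norm_num) hx
  change pd i (fun y => (pd m (fun y => u y l) y + pd l (fun y => u y m) y) / 2) x = _
  rw [pd_div_const _ ((h l m).fun_add (h m l)), pd_add (h l m) (h m l)]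

theorem pd_pd_strain (hΩ : IsOpen Ω) (hu : ContDiffOn ℝ 4 u Ω) (hx : x ∈ Ω) (l m i j : Fin 3) :
    pd j (pd i (strain u l m)) x
      = (pd j (pd i (pd m fun y => u y l)) x + pd j (pd i (pd l fun y => u y m)) x) / 2 := by
  have h : ∀ l m, DifferentiableAt ℝ (pd i (pd m fun y => u y l)) x := fun l m =>
    differentiableAt_of_contDiffOn hΩ (contDiffOn_pd_two hΩ
      (contDiffOn_pd_three hΩ (contDiffOn_component hu l) m) i) (by norm_num) hx
  rw [pd_eq_of_eqOn hΩ (fun y hy => pd_strain hΩ hu hy l m i) hx,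
    pd_div_const _ ((h l m).fun_add (h m l)), pd_add (h l m) (h m l)]

theorem pd_pd_pd_strain (hΩ : IsOpen Ω) (hu : ContDiffOn ℝ 4 u Ω) (hx : x ∈ Ω)
    (l m i j k : Fin 3) :
    pd k (pd j (pd i (strain u l m))) x
      = (pd k (pd j (pd i (pd m fun y => u y l))) x
        + pd k (pd j (pd i (pd l fun y => u y m))) x) / 2 := by
  have h : ∀ l m, DifferentiableAt ℝ (pd j (pd i (pd m fun y => u y l))) x := fun l m =>
    differentiableAt_of_contDiffOn hΩ (contDiffOn_pd_one hΩ (contDiffOn_pd_two hΩ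
      (contDiffOn_pd_three hΩ (contDiffOn_component hu l) m) i) j) (by norm_num) hx
  rw [pd_eq_of_eqOn hΩ (fun y hy => pd_pd_strain hΩ hu hy l m i j) hx,
    pd_div_const _ ((h l m).fun_add (h m l)), pd_add (h l m) (h m l)]

/-- A combination of the strain and its gradient with constant coefficients. -/
def strainCombination (u : E3 → E3) (a : Fin 3 → Fin 3 → ℝ) (b : Fin 3 → Fin 3 → Fin 3 → ℝ)
    (x : E3) : ℝ :=
  (∑ l, ∑ m, a l m * strain u l m x) + ∑ l, ∑ m, ∑ n, b l m n * pd n (strain u l m) x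

theorem pd_strainCombination (hΩ : IsOpen Ω) (hu : ContDiffOn ℝ 4 u Ω) (hx : x ∈ Ω)
    (a : Fin 3 → Fin 3 → ℝ) (b : Fin 3 → Fin 3 → Fin 3 → ℝ) (i : Fin 3) :
    pd i (strainCombination u a b) x = (∑ l, ∑ m, a l m * pd i (strain u l m) x)
      + ∑ l, ∑ m, ∑ n, b l m n * pd i (pd n (strain u l m)) x := by
  have h1 : ∀ l m, DifferentiableAt ℝ (strain u l m) x := fun l m =>
    differentiableAt_of_contDiffOn hΩ (contDiffOn_strain hΩ hu l m) (by norm_num) hx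
  have h2 : ∀ l m n, DifferentiableAt ℝ (pd n (strain u l m)) x := fun l m n =>
    differentiableAt_of_contDiffOn hΩ (contDiffOn_pd_two hΩ (contDiffOn_strain hΩ hu l m) n)
      (by norm_num) hx
  change pd i (fun y => (∑ l, ∑ m, a l m * strain u l m y)
    + ∑ l, ∑ m, ∑ n, b l m n * pd n (strain u l m) y) x = _
  rw [pd_add (by fun_prop) (by fun_prop), pd_sum _ (by intros; fun_prop),
    pd_sum _ (by intros; fun_prop)]
  congr 1
  · refine Finset.sum_congr rfl fun l _ => ?_
    rw [pd_sum _ (by intros; fun_prop)]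
    exact Finset.sum_congr rfl fun m _ => pd_const_mul _ (h1 l m) i
  · refine Finset.sum_congr rfl fun l _ => ?_
    rw [pd_sum _ (by intros; fun_prop)]
    refine Finset.sum_congr rfl fun m _ => ?_
    rw [pd_sum _ (by intros; fun_prop)]
    exact Finset.sum_congr rfl fun n _ => pd_const_mul _ (h2 l m n) i

theorem pd_pd_strainCombination (hΩ : IsOpen Ω) (hu : ContDiffOn ℝ 4 u Ω) (hx : x ∈ Ω)
    (a : Fin 3 → Fin 3 → ℝ) (b : Fin 3 → Fin 3 → Fin 3 → ℝ) (i j : Fin 3) :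
    pd j (pd i (strainCombination u a b)) x
      = (∑ l, ∑ m, a l m * pd j (pd i (strain u l m)) x)
        + ∑ l, ∑ m, ∑ n, b l m n * pd j (pd i (pd n (strain u l m))) x := by
  have h1 : ∀ l m n, DifferentiableAt ℝ (pd n (strain u l m)) x := fun l m n =>
    differentiableAt_of_contDiffOn hΩ (contDiffOn_pd_two hΩ (contDiffOn_strain hΩ hu l m) n)
      (by norm_num) hx
  have h2 : ∀ l m n i, DifferentiableAt ℝ (pd i (pd n (strain u l m))) x := fun l m n i =>
    differentiableAt_of_contDiffOn hΩ (contDiffOn_pd_one hΩ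
      (contDiffOn_pd_two hΩ (contDiffOn_strain hΩ hu l m) n) i) (by norm_num) hx
  rw [pd_eq_of_eqOn hΩ (fun y hy => pd_strainCombination hΩ hu hy a b i) hx]
  rw [pd_add (by fun_prop) (by fun_prop), pd_sum _ (by intros; fun_prop),
    pd_sum _ (by intros; fun_prop)]
  congr 1
  · refine Finset.sum_congr rfl fun l _ => ?_
    rw [pd_sum _ (by intros; fun_prop)]
    exact Finset.sum_congr rfl fun m _ => pd_const_mul _ (h1 l m i) j
  · refine Finset.sum_congr rfl fun l _ => ?_
    rw [pd_sum _ (by intros; fun_prop)]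
    refine Finset.sum_congr rfl fun m _ => ?_
    rw [pd_sum _ (by intros; fun_prop)]
    exact Finset.sum_congr rfl fun n _ => pd_const_mul _ (h2 l m n i) j

/-- The equilibrium equations of a `C⁴` field, written out in the derivatives of the strain. -/
theorem equilibriumAt_iff (L : Moduli) (hΩ : IsOpen Ω) (hu : ContDiffOn ℝ 4 u Ω) (hx : x ∈ Ω) :
    EquilibriumAt L u x ↔ ∀ k,
      (∑ i, ((∑ l, ∑ m, L.C i k l m * pd i (strain u l m) x)
        + ∑ l, ∑ m, ∑ n, L.M i k l m n * pd i (pd n (strain u l m)) x))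
      - ∑ i, ∑ j, ((∑ l, ∑ m, L.M l m i j k * pd j (pd i (strain u l m)) x)
        + ∑ l, ∑ m, ∑ n, L.A i j k l m n * pd j (pd i (pd n (strain u l m))) x) = 0 := by
  have h1 : ∀ i k, pd i (stress L u i k) x = _ := fun i k =>
    pd_strainCombination hΩ hu hx (L.C i k) (L.M i k) i
  have h2 : ∀ i j k, pd j (pd i (hyperStress L u i j k)) x = _ := fun i j k =>
    pd_pd_strainCombination hΩ hu hx (fun l m => L.M l m i j k) (L.A i j k) i j
  simp only [EquilibriumAt, h1, h2]

end Equilibrium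

/-! ### Signed cyclic permutation groups containing the two point groups. -/

section Groups

/-- The orthogonal matrices `Q i o = s i [o = i + c]` with signs `s` and a cyclic shift `c`, the
product of the signs belonging to `N`. -/
def signedCyclic (N : Subgroup ℤˣ) : Subgroup O3 where
  carrier := {Q | ∃ (s : Fin 3 → ℤˣ) (c : Fin 3), ∏ i, s i ∈ N ∧
    ∀ i o, Q.1 i o = if o = i + c then ((s i : ℤ) : ℝ) else 0}
  one_mem' := ⟨1, 0, by simp [N.one_mem], fun i o => by simp [Matrix.one_apply, eq_comm]⟩
  mul_mem' := by
    rintro P Q ⟨s, c, hs, hP⟩ ⟨t, d, ht, hQ⟩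
    refine ⟨fun i => s i * t (i + c), c + d, ?_, fun i o => ?_⟩
    · rw [Finset.prod_mul_distrib, Fintype.prod_equiv (Equiv.addRight c) (fun i => t (i + c)) t
        fun _ => rfl]
      exact N.mul_mem hs ht
    · change (P.1 * Q.1) i o = _
      simp only [Matrix.mul_apply, hP, hQ, ite_mul, zero_mul, Finset.sum_ite_eq', Finset.mem_univ, if_true]
      simp [add_assoc]
  inv_mem' := by
    rintro Q ⟨s, c, hs, hQ⟩
    refine ⟨fun i => s (i - c), -c, ?_, fun i o => ?_⟩
    · rwa [Fintype.prod_equiv (Equiv.subRight c) (fun i => s (i - c)) s fun _ => rfl]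
    · have : (Q⁻¹).1 i o = Q.1 o i := rfl
      rw [this, hQ, ← sub_eq_add_neg]
      by_cases h : i = o + c
      · subst h; simp
      · rw [if_neg h, if_neg fun h' => h (by simp [h'])]

theorem signedCyclic_mono {N N' : Subgroup ℤˣ} (h : N ≤ N') : signedCyclic N ≤ signedCyclic N' :=
  fun _ ⟨s, c, hs, hQ⟩ => ⟨s, c, h hs, hQ⟩

theorem halfTurn_apply (i o : Fin 3) :
    halfTurn.1 i o = if o = i + 0 then (((![-1, -1, 1] : Fin 3 → ℤˣ) i : ℤ) : ℝ) else 0 := by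
  fin_cases i <;> fin_cases o <;> simp [halfTurn]

theorem thirdTurn_apply (i o : Fin 3) :
    thirdTurn.1 i o = if o = i + 2 then (((1 : Fin 3 → ℤˣ) i : ℤ) : ℝ) else 0 := by
  fin_cases i <;> fin_cases o <;> simp [thirdTurn]

theorem neg_one_apply (i o : Fin 3) :
    (-1 : O3).1 i o = if o = i + 0 then (((-1 : Fin 3 → ℤˣ) i : ℤ) : ℝ) else 0 := by
  change (-1 : Matrix (Fin 3) (Fin 3) ℝ) i o = _
  fin_cases i <;> fin_cases o <;> simp

theorem groupT_le : groupT ≤ signedCyclic ⊥ := by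
  rw [groupT, Subgroup.closure_le]
  rintro Q (rfl | rfl)
  · exact ⟨_, 0, by simp [Fin.prod_univ_three], halfTurn_apply⟩
  · exact ⟨_, 2, by simp, thirdTurn_apply⟩

theorem groupTZ2c_le : groupTZ2c ≤ signedCyclic ⊤ := by
  refine sup_le (groupT_le.trans (signedCyclic_mono bot_le)) ?_
  rw [Subgroup.closure_le]
  rintro Q rfl
  exact ⟨_, 0, by simp, neg_one_apply⟩

end Groups

/-! ### Invariance of tensors as sign and index-shift identities. -/

section Invariance

variable {L : Moduli} {Q : O3} {s : Fin 3 → ℤˣ} {c : Fin 3}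

theorem mem_symC_iff (hQ : ∀ i o, Q.1 i o = if o = i + c then ((s i : ℤ) : ℝ) else 0) :
    Q ∈ L.symC ↔ ∀ i j k l,
      (s i : ℝ) * (s j) * (s k) * (s l) * L.C (i + c) (j + c) (k + c) (l + c) = L.C i j k l := by
  simp [Moduli.symC, hQ]

theorem mem_symM_iff (hQ : ∀ i o, Q.1 i o = if o = i + c then ((s i : ℤ) : ℝ) else 0) :
    Q ∈ L.symM ↔ ∀ i j k l m, (s i : ℝ) * (s j) * (s k) * (s l) * (s m)
      * L.M (i + c) (j + c) (k + c) (l + c) (m + c) = L.M i j k l m := by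
  simp [Moduli.symM, hQ]

theorem mem_symA_iff (hQ : ∀ i o, Q.1 i o = if o = i + c then ((s i : ℤ) : ℝ) else 0) :
    Q ∈ L.symA ↔ ∀ i j k l m n, (s i : ℝ) * (s j) * (s k) * (s l) * (s m) * (s n)
      * L.A (i + c) (j + c) (k + c) (l + c) (m + c) (n + c) = L.A i j k l m n := by
  simp [Moduli.symA, hQ]


/-- Each row of a signed cyclic matrix has one nonzero entry, so the multiple sums defining
invariance collapse to one term. -/
theorem signedCyclic_subset_sym {N : Subgroup ℤˣ}
    (hC : ∀ (s : Fin 3 → ℤˣ) (c : Fin 3), ∏ i, s i ∈ N → ∀ i j k l,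
      (s i : ℝ) * (s j) * (s k) * (s l) * L.C (i + c) (j + c) (k + c) (l + c) = L.C i j k l)
    (hM : ∀ (s : Fin 3 → ℤˣ) (c : Fin 3), ∏ i, s i ∈ N → ∀ i j k l m,
      (s i : ℝ) * (s j) * (s k) * (s l) * (s m)
        * L.M (i + c) (j + c) (k + c) (l + c) (m + c) = L.M i j k l m)
    (hA : ∀ (s : Fin 3 → ℤˣ) (c : Fin 3), ∏ i, s i ∈ N → ∀ i j k l m n,
      (s i : ℝ) * (s j) * (s k) * (s l) * (s m) * (s n)
        * L.A (i + c) (j + c) (k + c) (l + c) (m + c) (n + c) = L.A i j k l m n) :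
    (signedCyclic N : Set O3) ⊆ L.sym := by
  rintro Q ⟨s, c, hs, hQ⟩
  exact ⟨⟨(mem_symA_iff hQ).2 (hA s c hs), (mem_symM_iff hQ).2 (hM s c hs)⟩,
    (mem_symC_iff hQ).2 (hC s c hs)⟩

theorem sign_mul_self (s : ℤˣ) : (s : ℝ) * s = 1 := by
  rcases Int.units_eq_one_or s with rfl | rfl <;> simp

theorem sign_mul_sign_add_one_mul_sign_add_two {s : Fin 3 → ℤˣ} (hs : ∏ i, s i ∈ (⊥ : Subgroup ℤˣ))
    (a : Fin 3) : (s a : ℝ) * s (a + 1) * s (a + 2) = 1 := by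
  have h : s 0 * s 1 * s 2 = 1 := by simpa [Fin.prod_univ_three] using hs
  have h' : (s 0 : ℝ) * s 1 * s 2 = 1 := by
    simpa using congrArg (fun z : ℤˣ => ((z : ℤ) : ℝ)) h
  fin_cases a
  · exact h'
  · change (s 1 : ℝ) * s 2 * s 0 = 1
    linarith
  · change (s 2 : ℝ) * s 0 * s 1 = 1
    linarith

end Invariance

/-! ### Test materials and their invariance. -/

section SpecialModuli

/-- The solid whose only non-zero moduli are `C₁₁₁₁ = C₂₂₂₂ = C₃₃₃₃ = 1`. -/
def cubicModuli : Moduli where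
  C i j l m := if i = j ∧ l = j ∧ m = j then 1 else 0
  M _ _ _ _ _ := 0
  A _ _ _ _ _ _ := 0
  C_minor _ _ _ _ := by grind
  C_major _ _ _ _ := by grind
  M_minor_left _ _ _ _ _ := rfl
  M_minor_right _ _ _ _ _ := rfl
  A_minor _ _ _ _ _ _ := rfl
  A_major _ _ _ _ _ _ := rfl

/-- The isotropic solid with the Lamé constants `lam` and `mu`, without strain-gradient moduli. -/
def isotropicModuli (lam mu : ℝ) : Moduli where
  C i j l m := lam * (if i = j then if m = l then 1 else 0 else 0)
    + mu * ((if l = i then if m = j then 1 else 0 else 0)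
      + if m = i then if l = j then 1 else 0 else 0)
  M _ _ _ _ _ := 0
  A _ _ _ _ _ _ := 0
  C_minor _ _ _ _ := by grind
  C_major _ _ _ _ := by grind
  M_minor_left _ _ _ _ _ := rfl
  M_minor_right _ _ _ _ _ := rfl
  A_minor _ _ _ _ _ _ := rfl
  A_major _ _ _ _ _ _ := rfl

/-- A solid of the class `𝕋` with only fifth-order moduli; `d` is `1` or `2`. -/
def chiralModuli (d : Fin 3) : Moduli where
  C _ _ _ _ := 0
  M i j k l m := if i = j then if m = i + d + d then
    (if k = i then if l = i + d then 1 else 0 else 0)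
      + (if l = i then if k = i + d then 1 else 0 else 0) else 0 else 0
  A _ _ _ _ _ _ := 0
  C_minor _ _ _ _ := rfl
  C_major _ _ _ _ := rfl
  M_minor_left _ _ _ _ _ := by grind
  M_minor_right _ _ _ _ _ := by grind
  A_minor _ _ _ _ _ _ := rfl
  A_major _ _ _ _ _ _ := rfl

/-- A solid of the class `𝕋 ⊕ ℤ₂ᶜ` with only sixth-order moduli. -/
def gradientModuli : Moduli where
  C _ _ _ _ := 0
  M _ _ _ _ _ := 0
  A i j k l m n :=
    (if i = k + 1 then if j = k + 1 then if n = k + 1 then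
      (if l = k then if m = k + 1 then 1 else 0 else 0)
        + (if m = k then if l = k + 1 then 1 else 0 else 0) else 0 else 0 else 0)
    + (if k = n + 1 then if l = n + 1 then if m = n + 1 then
      (if i = n then if j = n + 1 then 1 else 0 else 0)
        + (if j = n then if i = n + 1 then 1 else 0 else 0) else 0 else 0 else 0)
  C_minor _ _ _ _ := rfl
  C_major _ _ _ _ := rfl
  M_minor_left _ _ _ _ _ := rfl
  M_minor_right _ _ _ _ _ := rfl
  A_minor _ _ _ _ _ _ := by grind
  A_major _ _ _ _ _ _ := by grind

theorem signedCyclic_subset_sym_cubicModuli :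
    (signedCyclic ⊤ : Set O3) ⊆ cubicModuli.sym := by
  refine signedCyclic_subset_sym (fun s c _ i j k l => ?_) (by simp [cubicModuli])
    (by simp [cubicModuli])
  simp only [cubicModuli, add_left_inj]
  have := sign_mul_self (s j)
  split_ifs with h
  · obtain ⟨rfl, rfl, rfl⟩ := h
    grind
  · simp

theorem signedCyclic_subset_sym_isotropicModuli (lam mu : ℝ) :
    (signedCyclic ⊤ : Set O3) ⊆ (isotropicModuli lam mu).sym := by
  refine signedCyclic_subset_sym (fun s c _ i j k l => ?_) (by simp [isotropicModuli])
    (by simp [isotropicModuli])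
  simp only [isotropicModuli, add_left_inj]
  have h := fun j => sign_mul_self (s j)
  have h1 := h i
  have h2 := h j
  have h3 := h k
  have h4 := h l
  split_ifs <;> subst_vars <;> simp <;> grind

theorem signedCyclic_subset_sym_chiralModuli (d : Fin 3) (hd : d = 1 ∨ d = 2) :
    (signedCyclic ⊥ : Set O3) ⊆ (chiralModuli d).sym := by
  refine signedCyclic_subset_sym (by simp [chiralModuli]) (fun s c hs i j k l m => ?_)
    (by simp [chiralModuli])
  simp only [chiralModuli, add_left_inj, add_right_comm _ c]
  have h1 := sign_mul_self (s i)
  have h2 : (s i : ℝ) * s (i + d) * s (i + d + d) = 1 := by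
    have := sign_mul_sign_add_one_mul_sign_add_two hs i
    rcases hd with rfl | rfl
    · simpa [add_assoc] using this
    · rw [add_assoc]
      change (s i : ℝ) * s (i + 2) * s (i + 1) = 1
      linarith
  split_ifs <;> subst_vars <;> simp <;> grind

theorem signedCyclic_subset_sym_gradientModuli :
    (signedCyclic ⊤ : Set O3) ⊆ gradientModuli.sym := by
  refine signedCyclic_subset_sym (by simp [gradientModuli]) (by simp [gradientModuli])
    (fun s c _ i j k l m n => ?_)
  simp only [gradientModuli, add_left_inj, add_right_comm _ c]
  rw [mul_add]
  congr 1
  · have h1 := sign_mul_self (s k)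
    have h2 := sign_mul_self (s (k + 1))
    split_ifs <;> subst_vars <;> simp <;> grind
  · have h1 := sign_mul_self (s n)
    have h2 := sign_mul_self (s (n + 1))
    split_ifs <;> subst_vars <;> simp <;> grind

end SpecialModuli

/-! ### Equilibrium equations of the test materials. -/

section EquilibriumOfSpecialModuli

variable {Ω : Set E3} {u : E3 → E3} {x : E3}

theorem equilibriumAt_cubicModuli_iff (hΩ : IsOpen Ω) (hu : ContDiffOn ℝ 4 u Ω) (hx : x ∈ Ω) :
    EquilibriumAt cubicModuli u x ↔ ∀ k, pd k (strain u k k) x = 0 := by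
  rw [equilibriumAt_iff _ hΩ hu hx]
  simp [cubicModuli, ite_and]

theorem equilibriumAt_isotropicModuli_iff (lam mu : ℝ) (hΩ : IsOpen Ω) (hu : ContDiffOn ℝ 4 u Ω)
    (hx : x ∈ Ω) :
    EquilibriumAt (isotropicModuli lam mu) u x ↔ ∀ k,
      lam * ∑ l, pd k (strain u l l) x + mu * ∑ i, (pd i (strain u i k) x + pd i (strain u k i) x)
        = 0 := by
  rw [equilibriumAt_iff _ hΩ hu hx]
  simp [isotropicModuli, add_mul, Finset.sum_add_distrib, ← Finset.mul_sum, mul_add]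

theorem equilibriumAt_chiralModuli_iff (d : Fin 3) (hΩ : IsOpen Ω) (hu : ContDiffOn ℝ 4 u Ω)
    (hx : x ∈ Ω) :
    EquilibriumAt (chiralModuli d) u x ↔ ∀ k,
      pd k (pd (k + d + d) (strain u k (k + d))) x + pd k (pd (k + d + d) (strain u (k + d) k)) x
      - (pd (k - d) (pd (k - d - d) (strain u (k - d - d) (k - d - d))) x
        + pd (k - d - d) (pd (k - d) (strain u (k - d - d) (k - d - d))) x) = 0 := by
  rw [equilibriumAt_iff _ hΩ hu hx]
  refine forall_congr' fun k => ?_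
  have h : ∀ y, k = y + d + d ↔ y = k - d - d := by grind
  simp [chiralModuli, add_mul, Finset.sum_add_distrib, h]

theorem equilibriumAt_gradientModuli_iff (hΩ : IsOpen Ω) (hu : ContDiffOn ℝ 4 u Ω) (hx : x ∈ Ω) :
    EquilibriumAt gradientModuli u x ↔ ∀ k,
      pd (k + 1) (pd (k + 1) (pd (k + 1) (strain u (k + 1) k))) x
      + pd (k + 1) (pd (k + 1) (pd (k + 1) (strain u k (k + 1)))) x
      + pd k (pd (k - 1) (pd (k - 1) (strain u k k))) x
      + pd (k - 1) (pd k (pd (k - 1) (strain u k k))) x = 0 := by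
  rw [equilibriumAt_iff _ hΩ hu hx]
  refine forall_congr' fun k => ?_
  have h : ∀ y, k = y + 1 ↔ y = k - 1 := by grind
  simp [gradientModuli, add_mul, Finset.sum_add_distrib, h]
  constructor <;> intro h <;> linarith

end EquilibriumOfSpecialModuli

/-! ### Differential relations forced on a universal displacement. -/

section Relations

variable {Ω : Set E3} {u : E3 → E3} {G : Subgroup O3} {f : E3 → ℝ} {x : E3}

theorem sum_fin_three_of_ne (F : Fin 3 → ℝ) {i j k : Fin 3} (hij : i ≠ j) (hik : i ≠ k)
    (hjk : j ≠ k) : ∑ l, F l = F i + F j + F k := by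
  have h : (Finset.univ : Finset (Fin 3)) = {i, j, k} := by decide +revert
  rw [h, Finset.sum_insert (by simp [hij, hik]), Finset.sum_pair hjk, add_assoc]

theorem IsUniversalDisplacement.equilibriumAt {N : Subgroup ℤˣ}
    (hu : IsUniversalDisplacement G Ω u) (hG : G ≤ signedCyclic N) {L : Moduli}
    (hL : (signedCyclic N : Set O3) ⊆ L.sym) (hx : x ∈ Ω) : EquilibriumAt L u x :=
  hu.2 L (Subset.trans hG hL) x hx

theorem IsUniversalDisplacement.pd_pd_self (hΩ : IsOpen Ω) (hu : IsUniversalDisplacement G Ω u)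
    (hG : G ≤ signedCyclic ⊤) (k : Fin 3) (hx : x ∈ Ω) : pd k (pd k fun y => u y k) x = 0 := by
  have h := (equilibriumAt_cubicModuli_iff hΩ hu.1 hx).1
    (hu.equilibriumAt hG signedCyclic_subset_sym_cubicModuli hx) k
  rw [pd_strain hΩ hu.1 hx] at h
  linarith

theorem IsUniversalDisplacement.pd_div (hΩ : IsOpen Ω) (hu : IsUniversalDisplacement G Ω u)
    (hG : G ≤ signedCyclic ⊤) (k : Fin 3) (hx : x ∈ Ω) :
    ∑ l, pd k (pd l fun y => u y l) x = 0 := by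
  have h := (equilibriumAt_isotropicModuli_iff 1 0 hΩ hu.1 hx).1
    (hu.equilibriumAt hG (signedCyclic_subset_sym_isotropicModuli 1 0) hx) k
  simpa [pd_strain hΩ hu.1 hx] using h

/-- The shear term of the isotropic equation is `Δu_k + ∂_k div u`, and the second summand is
already zero. -/
theorem IsUniversalDisplacement.sum_pd_pd (hΩ : IsOpen Ω) (hu : IsUniversalDisplacement G Ω u)
    (hG : G ≤ signedCyclic ⊤) (k : Fin 3) (hx : x ∈ Ω) :
    ∑ i, pd i (pd i fun y => u y k) x = 0 := by
  have h := (equilibriumAt_isotropicModuli_iff 0 1 hΩ hu.1 hx).1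
    (hu.equilibriumAt hG (signedCyclic_subset_sym_isotropicModuli 0 1) hx) k
  have hc : ∀ i, pd i (pd k fun y => u y i) x = pd k (pd i fun y => u y i) x := fun i =>
    pd_comm hΩ ((contDiffOn_component hu.1 i).of_le (by norm_num)) hx i k
  have hd := hu.pd_div hΩ hG k hx
  simp only [pd_strain hΩ hu.1 hx, hc, Fin.sum_univ_three] at h hd ⊢
  linarith

theorem pd_pd_pd_eq_zero (hΩ : IsOpen Ω) (hf : ContDiffOn ℝ 3 f Ω) {k : Fin 3}
    (hk : ∀ y ∈ Ω, pd k (pd k f) y = 0) (p : Fin 3) (hx : x ∈ Ω) :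
    pd p (pd k (pd k f)) x = 0 ∧ pd k (pd p (pd k f)) x = 0 ∧ pd k (pd k (pd p f)) x = 0 := by
  have h1 := pd_eq_zero_of_eqOn_zero hΩ hk hx p
  have h2 : pd k (pd p (pd k f)) x = 0 := by
    rw [pd_comm hΩ (contDiffOn_pd_two hΩ hf k) hx, h1]
  refine ⟨h1, h2, ?_⟩
  rw [pd_eq_of_eqOn hΩ (fun y hy => pd_comm hΩ (hf.of_le (by norm_num)) hy k p) hx, h2]

/-- In the equation of `gradientModuli` every other term contains a second derivative `u_{l,ll}`,
which vanishes. This includes the terms due to the transposed half of `A`, needed for major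
symmetry. -/
theorem IsUniversalDisplacement.pd_four (hΩ : IsOpen Ω) (hu : IsUniversalDisplacement G Ω u)
    (hG : G ≤ signedCyclic ⊤) (k : Fin 3) (hx : x ∈ Ω) :
    pd (k + 1) (pd (k + 1) (pd (k + 1) (pd (k + 1) fun y => u y k))) x = 0 := by
  have h := (equilibriumAt_gradientModuli_iff hΩ hu.1 hx).1
    (hu.equilibriumAt hG signedCyclic_subset_sym_gradientModuli hx) k
  have hU := fun l => contDiffOn_component hu.1 l
  have hz : ∀ l p, ∀ y ∈ Ω, _ := fun l p y hy => pd_pd_pd_eq_zero hΩ ((hU l).of_le (by norm_num))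
    (fun y hy => hu.pd_pd_self hΩ hG l hy) p hy
  have h1 : pd (k + 1) (pd (k + 1) (pd (k + 1) (pd k fun y => u y (k + 1)))) x = 0 :=
    pd_eq_zero_of_eqOn_zero hΩ (fun y hy => (hz (k + 1) k y hy).2.2) hx _
  have h2 : pd (k - 1) (pd k (pd (k - 1) (pd k fun y => u y k))) x = 0 :=
    pd_eq_zero_of_eqOn_zero hΩ (fun y hy => (hz k (k - 1) y hy).2.1) hx _
  have h3 : pd k (pd (k - 1) (pd (k - 1) (pd k fun y => u y k))) x = 0 := by
    rw [pd_comm hΩ (contDiffOn_pd_two hΩ (contDiffOn_pd_three hΩ (hU k) _) _) hx, h2]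
  simp only [pd_pd_pd_strain hΩ hu.1 hx, h1, h2, h3] at h
  linarith

/-- The hyperstress part of the `chiralModuli` equation contains `u_{i,ii}` and drops out, leaving
`u_{i,jjk} + u_{j,ijk} = 0`. The second term vanishes by the divergence relation. -/
theorem IsUniversalDisplacement.pd_three (hΩ : IsOpen Ω) (hu : IsUniversalDisplacement G Ω u)
    (hG : G ≤ signedCyclic ⊥) {i j k : Fin 3} (hij : i ≠ j) (hik : i ≠ k) (hjk : j ≠ k)
    (hx : x ∈ Ω) : pd j (pd k (pd j fun y => u y i)) x = 0 := by
  have hG' := hG.trans (signedCyclic_mono (N' := ⊤) bot_le)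
  -- The orientation of `(j, i, k)` selects which of the two chiral materials is tested.
  obtain ⟨d, hd, rfl, rfl⟩ : ∃ d : Fin 3, (d = 1 ∨ d = 2) ∧ i = j + d ∧ k = j + d + d :=
    ⟨i - j, by grind, by grind, by grind⟩
  have h := (equilibriumAt_chiralModuli_iff d hΩ hu.1 hx).1
    (hu.equilibriumAt hG (signedCyclic_subset_sym_chiralModuli d hd) hx) j
  have e1 : j - d - d = j + d := by grind
  have e2 : j - d = j + d + d := by grind
  rw [e1, e2] at h
  have hU := fun l => contDiffOn_component hu.1 l
  have hz : ∀ l p, ∀ y ∈ Ω, _ := fun l p y hy => pd_pd_pd_eq_zero hΩ ((hU l).of_le (by norm_num))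
    (fun y hy => hu.pd_pd_self hΩ hG' l hy) p hy
  have h1 := (hz (j + d) (j + d + d) x hx).1
  have h2 := (hz (j + d) (j + d + d) x hx).2.1
  simp only [pd_pd_strain hΩ hu.1 hx, h1, h2] at h
  -- From `∂_i div u = 0` and `u_{i,ii} = 0` follows `u_{j,ji} = -u_{k,ki}`; its derivative in `x_k`
  -- contains `u_{k,kk}`.
  have h3 : pd j (pd (j + d + d) (pd (j + d) fun y => u y j)) x = 0 := by
    have hC : ∀ l, ContDiffOn ℝ 2 (fun y => u y l) Ω := fun l => (hU l).of_le (by norm_num)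
    have hdiv : ∀ y ∈ Ω, pd (j + d) (pd j fun y => u y j) y
        = -pd (j + d) (pd (j + d + d) fun y => u y (j + d + d)) y := by
      intro y hy
      have h := hu.pd_div hΩ hG' (j + d) hy
      have h0 := hu.pd_pd_self hΩ hG' (j + d) hy
      rw [sum_fin_three_of_ne _ hij.symm hjk hik] at h
      linarith
    rw [pd_comm hΩ (contDiffOn_pd_two hΩ ((hU j).of_le (by norm_num)) _) hx,
      pd_eq_of_eqOn hΩ (fun y hy => pd_comm hΩ (hC j) hy _ _) hx,
      pd_eq_of_eqOn hΩ hdiv hx, pd_neg, (hz (j + d + d) (j + d) x hx).2.1, neg_zero]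
  linarith

end Relations

/-! ### Polynomial functions and integration of polynomial gradients. -/

section PolynomialFunctions

/-- The function on Euclidean space given by a polynomial. -/
def polyFun {n : ℕ} (p : MvPolynomial (Fin n) ℝ) (x : EuclideanSpace ℝ (Fin n)) : ℝ :=
  eval (fun i => x i) p

theorem polyFun_C {n : ℕ} (a : ℝ) : polyFun (C a : MvPolynomial (Fin n) ℝ) = fun _ => a := by
  ext; simp [polyFun]

theorem polyFun_add {n : ℕ} (p q : MvPolynomial (Fin n) ℝ) :
    polyFun (p + q) = fun x => polyFun p x + polyFun q x := by
  ext; simp [polyFun]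

theorem polyFun_mul {n : ℕ} (p q : MvPolynomial (Fin n) ℝ) :
    polyFun (p * q) = fun x => polyFun p x * polyFun q x := by
  ext; simp [polyFun]

theorem polyFun_X {n : ℕ} (j : Fin n) : polyFun (X j) = fun x => x j := by
  ext; simp [polyFun]

@[simp]
theorem pderiv_ofNat {n : ℕ} (i : Fin n) (m : ℕ) [m.AtLeastTwo] :
    pderiv i (ofNat(m) : MvPolynomial (Fin n) ℝ) = 0 := by
  rw [← map_ofNat (C : ℝ →+* MvPolynomial (Fin n) ℝ), pderiv_C]

theorem hasFDerivAt_polyFun {n : ℕ} (p : MvPolynomial (Fin n) ℝ) (x : EuclideanSpace ℝ (Fin n)) :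
    HasFDerivAt (polyFun p) (∑ i, polyFun (pderiv i p) x •
      (EuclideanSpace.proj i : EuclideanSpace ℝ (Fin n) →L[ℝ] ℝ)) x := by
  induction p using MvPolynomial.induction_on with
  | C a => simpa [polyFun_C, polyFun] using hasFDerivAt_const a x
  | add p q hp hq =>
    have h := hp.fun_add hq
    rw [← Finset.sum_add_distrib] at h
    simpa only [map_add, polyFun_add, add_smul] using h
  | mul_X p j hp =>
    have hX : HasFDerivAt (fun y : EuclideanSpace ℝ (Fin n) => y j)
        (EuclideanSpace.proj j : EuclideanSpace ℝ (Fin n) →L[ℝ] ℝ) x :=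
      (EuclideanSpace.proj j : EuclideanSpace ℝ (Fin n) →L[ℝ] ℝ).hasFDerivAt
    rw [polyFun_mul, polyFun_X]
    refine (hp.mul hX).congr_fderiv ?_
    ext v
    simp [polyFun, pderiv_X, Pi.single_apply, apply_ite, ite_mul, add_mul,
      Finset.sum_add_distrib, Finset.mul_sum, mul_assoc]

theorem fderiv_polyFun_single {n : ℕ} (p : MvPolynomial (Fin n) ℝ) (x : EuclideanSpace ℝ (Fin n))
    (i : Fin n) : fderiv ℝ (polyFun p) x (EuclideanSpace.single i 1) = polyFun (pderiv i p) x := by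
  rw [(hasFDerivAt_polyFun p x).fderiv]
  simp

theorem contDiff_polyFun {n : ℕ} {m : WithTop ℕ∞} (p : MvPolynomial (Fin n) ℝ) :
    ContDiff ℝ m (polyFun p) := by
  induction p using MvPolynomial.induction_on with
  | C a => simpa [polyFun_C] using contDiff_const
  | add p q hp hq => simpa [polyFun_add] using hp.add hq
  | mul_X p j hp =>
    have hX : ContDiff ℝ m (fun y : EuclideanSpace ℝ (Fin n) => y j) :=
      (EuclideanSpace.proj j : EuclideanSpace ℝ (Fin n) →L[ℝ] ℝ).contDiff
    simpa [polyFun_mul, polyFun_X] using hp.mul hX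

theorem pd_polyFun (p : MvPolynomial (Fin 3) ℝ) (i : Fin 3) :
    pd i (polyFun p) = polyFun (pderiv i p) :=
  funext fun x => fderiv_polyFun_single p x i

open InnerProductSpace in
theorem laplacian_polyFun {n : ℕ} (p : MvPolynomial (Fin n) ℝ) (x : EuclideanSpace ℝ (Fin n)) :
    Laplacian.laplacian (polyFun p) x = polyFun (∑ i, pderiv i (pderiv i p)) x := by
  have hd : DifferentiableAt ℝ (fderiv ℝ (polyFun p)) x :=
    ((contDiff_polyFun p).fderiv_right (m := 1) (n := 2) (by norm_num)).differentiable
      one_ne_zero x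
  have key : ∀ i, fderiv ℝ (fderiv ℝ (polyFun p)) x (EuclideanSpace.single i 1)
      (EuclideanSpace.single i 1) = polyFun (pderiv i (pderiv i p)) x := by
    intro i
    rw [← fderiv_polyFun_single (pderiv i p), ← funext fun y => fderiv_polyFun_single p y i,
      fderiv_clm_apply hd (differentiableAt_const _)]
    simp
  rw [laplacian_eq_iteratedFDeriv_orthonormalBasis _ (EuclideanSpace.basisFun (Fin n) ℝ)]
  simp only [iteratedFDeriv_two_apply]
  simp [key, polyFun]

variable {Ω : Set E3} {f : E3 → ℝ}

theorem exists_eq_polyFun_add_const (hΩ : IsOpen Ω) (hc : IsPreconnected Ω)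
    (hf : DifferentiableOn ℝ f Ω) (p : MvPolynomial (Fin 3) ℝ)
    (h : ∀ i, ∀ x ∈ Ω, pd i f x = polyFun (pderiv i p) x) :
    ∃ c, ∀ x ∈ Ω, f x = polyFun (p + C c) x := by
  have hp : Differentiable ℝ (polyFun p) := (contDiff_polyFun (m := 1) p).differentiable one_ne_zero
  obtain ⟨c, hcst⟩ := exists_eq_const_of_pd_eq_zero (f := fun x => f x - polyFun p x) hΩ hc
    (hf.sub hp.differentiableOn) fun i x hx => by
      rw [pd_sub ((hf x hx).differentiableAt (hΩ.mem_nhds hx)) (hp x), h i x hx, pd_polyFun,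
        sub_self]
  refine ⟨c, fun x hx => ?_⟩
  have := hcst x hx
  simp only [polyFun, map_add, eval_C] at this ⊢
  linarith

/-- The harmonic polynomials of degree at most four that are cubic in each variable. -/
def harmonicPoly {R : Type*} [CommRing R] (c : Fin 8 → R) (s t : R) : R :=
  c 0 * (s ^ 3 * t - s * t ^ 3) + c 1 * (s ^ 3 - 3 * s * t ^ 2) + c 2 * (3 * s ^ 2 * t - t ^ 3)
    + c 3 * (s ^ 2 - t ^ 2) + c 4 * (s * t) + c 5 * s + c 6 * t + c 7

theorem eq_or_eq_or_eq_of_ne {i j k : Fin 3} (hij : i ≠ j) (hik : i ≠ k) (hjk : j ≠ k)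
    (n : Fin 3) : n = i ∨ n = j ∨ n = k := by
  decide +revert

/-- Once `f_{jj}` is known, harmonicity gives `f_{kk} = -f_{jj}`. Successive integration over the
connected set recovers `f_{jk}`, `f_j`, `f_k` and `f`, each with one new constant. -/
theorem exists_eq_harmonicPoly (hΩ : IsOpen Ω) (hc : IsPreconnected Ω) (hf : ContDiffOn ℝ 4 f Ω)
    {i j k : Fin 3} (hij : i ≠ j) (hik : i ≠ k) (hjk : j ≠ k) (hi : ∀ x ∈ Ω, pd i f x = 0)
    (hL : ∀ x ∈ Ω, pd j (pd j f) x + pd k (pd k f) x = 0) (c₀ c₁ c₂ c₃ : ℝ)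
    (hjj : ∀ x ∈ Ω, pd j (pd j f) x
      = polyFun (C (6 * c₀) * X j * X k + C (6 * c₁) * X j + C (6 * c₂) * X k + C (2 * c₃)) x) :
    ∃ c₄ c₅ c₆ c₇, ∀ x ∈ Ω, f x = harmonicPoly ![c₀, c₁, c₂, c₃, c₄, c₅, c₆, c₇] (x j) (x k) := by
  have hcases := eq_or_eq_or_eq_of_ne hij hik hjk
  have hC3 := fun n => contDiffOn_pd_three hΩ hf n
  have hC2 := fun n m => contDiffOn_pd_two hΩ (hC3 n) m
  have hf2 : ContDiffOn ℝ 2 f Ω := hf.of_le (by norm_num)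
  have hij' := hij.symm
  have hik' := hik.symm
  have hjk' := hjk.symm
  have hin : ∀ n, ∀ x ∈ Ω, pd i (pd n f) x = 0 := fun n x hx => by
    rw [pd_comm hΩ hf2 hx]
    exact pd_eq_zero_of_eqOn_zero hΩ hi hx n
  have hkk : ∀ x ∈ Ω, pd k (pd k f) x = - polyFun (C (6 * c₀) * X j * X k + C (6 * c₁) * X j
      + C (6 * c₂) * X k + C (2 * c₃)) x := fun x hx => by
    have := hL x hx
    rw [hjj x hx] at this
    linarith
  obtain ⟨c₄, h4⟩ := exists_eq_polyFun_add_const (f := pd k (pd j f)) hΩ hc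
    ((hC2 j k).differentiableOn (by norm_num))
    (C (3 * c₀) * (X j ^ 2 - X k ^ 2) + C (6 * c₂) * X j - C (6 * c₁) * X k) fun n x hx => by
      rcases hcases n with rfl | rfl | rfl
      · rw [pd_comm hΩ ((hC3 j).of_le (by norm_num)) hx,
          pd_eq_zero_of_eqOn_zero hΩ (hin j) hx]
        simp [polyFun, *]
      · rw [pd_comm hΩ ((hC3 n).of_le (by norm_num)) hx, pd_eq_of_eqOn hΩ hjj hx, pd_polyFun]
        simp [polyFun, *]
        ring
      · rw [pd_eq_of_eqOn hΩ (fun y hy => pd_comm hΩ hf2 hy n j) hx,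
          pd_comm hΩ ((hC3 n).of_le (by norm_num)) hx, pd_eq_of_eqOn hΩ hkk hx, pd_neg, pd_polyFun]
        simp [polyFun, *]
        ring
  obtain ⟨c₅, h5⟩ := exists_eq_polyFun_add_const (f := pd j f) hΩ hc
    ((hC3 j).differentiableOn (by norm_num))
    (C c₀ * (3 * X j ^ 2 * X k - X k ^ 3) + C (3 * c₁) * (X j ^ 2 - X k ^ 2)
      + C (6 * c₂) * X j * X k + C (2 * c₃) * X j + C c₄ * X k) fun n x hx => by
      rcases hcases n with rfl | rfl | rfl
      · rw [hin j x hx]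
        simp [polyFun, *]
      · rw [hjj x hx]
        simp [polyFun, *]
        ring
      · rw [h4 x hx]
        simp [polyFun, *]
        ring
  obtain ⟨c₆, h6⟩ := exists_eq_polyFun_add_const (f := pd k f) hΩ hc
    ((hC3 k).differentiableOn (by norm_num))
    (C c₀ * (X j ^ 3 - 3 * X j * X k ^ 2) - C (6 * c₁) * X j * X k
      + C (3 * c₂) * (X j ^ 2 - X k ^ 2) - C (2 * c₃) * X k + C c₄ * X j) fun n x hx => by
      rcases hcases n with rfl | rfl | rfl
      · rw [hin k x hx]
        simp [polyFun, *]
      · rw [pd_comm hΩ hf2 hx, h4 x hx]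
        simp [polyFun, *]
        ring
      · rw [hkk x hx]
        simp [polyFun, *]
        ring
  obtain ⟨c₇, h7⟩ := exists_eq_polyFun_add_const hΩ hc (hf.differentiableOn (by norm_num))
    (C c₀ * (X j ^ 3 * X k - X j * X k ^ 3) + C c₁ * (X j ^ 3 - 3 * X j * X k ^ 2)
      + C c₂ * (3 * X j ^ 2 * X k - X k ^ 3) + C c₃ * (X j ^ 2 - X k ^ 2) + C c₄ * (X j * X k)
      + C c₅ * X j + C c₆ * X k) fun n x hx => by
      rcases hcases n with rfl | rfl | rfl
      · rw [hi x hx]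
        simp [polyFun, *]
      · rw [h5 x hx]
        simp [polyFun, *]
        ring
      · rw [h6 x hx]
        simp [polyFun, *]
        ring
  refine ⟨c₄, c₅, c₆, c₇, fun x hx => ?_⟩
  rw [h7 x hx]
  simp [polyFun, harmonicPoly]

end PolynomialFunctions

/-! ### Components as explicit polynomials. -/

section HarmonicFields

variable {Ω : Set E3} {f : E3 → ℝ} {x : E3}

theorem pd_pd_pd_pd_comm (hΩ : IsOpen Ω) (hf : ContDiffOn ℝ 4 f Ω) (j k : Fin 3) (hx : x ∈ Ω) :
    pd k (pd k (pd j (pd j f))) x = pd j (pd j (pd k (pd k f))) x := by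
  have h2 : ContDiffOn ℝ 2 f Ω := hf.of_le (by norm_num)
  have h3 := fun n => contDiffOn_pd_three hΩ hf n
  have h3' : ∀ n, ContDiffOn ℝ 2 (pd n f) Ω := fun n => (h3 n).of_le (by norm_num)
  rw [pd_eq_of_eqOn hΩ (fun y hy => pd_comm hΩ (h3' j) hy k j) hx,
    pd_comm hΩ (contDiffOn_pd_two hΩ (h3 j) k) hx]
  refine pd_eq_of_eqOn hΩ (fun y hy => ?_) hx j
  rw [pd_eq_of_eqOn hΩ (fun z hz => pd_comm hΩ h2 hz k j) hy, pd_comm hΩ (h3' k) hy]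

/-- With `w = f_{jj}`, the hypothesis says `w_{jj} = 0`, and harmonicity of `f` turns it into
`w_{kk} = 0`. Hence `w` is affine in `x_j` and in `x_k` separately. -/
theorem exists_eq_harmonicPoly_of_pd_four (hΩ : IsOpen Ω) (hc : IsPreconnected Ω)
    (hf : ContDiffOn ℝ 4 f Ω) {i j k : Fin 3} (hij : i ≠ j) (hik : i ≠ k) (hjk : j ≠ k)
    (hi : ∀ x ∈ Ω, pd i f x = 0) (hL : ∀ x ∈ Ω, pd j (pd j f) x + pd k (pd k f) x = 0)
    (h4 : ∀ x ∈ Ω, pd j (pd j (pd j (pd j f))) x = 0) :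
    ∃ c : Fin 8 → ℝ, ∀ x ∈ Ω, f x = harmonicPoly c (x j) (x k) := by
  have hcases := eq_or_eq_or_eq_of_ne hij hik hjk
  have hij' := hij.symm
  have hik' := hik.symm
  have hjk' := hjk.symm
  have hC3 := fun n => contDiffOn_pd_three hΩ hf n
  set w := pd j (pd j f)
  have hw : ContDiffOn ℝ 2 w Ω := contDiffOn_pd_two hΩ (hC3 j) j
  have hw1 := fun n => contDiffOn_pd_one hΩ hw n
  have hwi : ∀ y ∈ Ω, pd i w y = 0 := fun y hy => by
    rw [pd_comm hΩ ((hC3 j).of_le (by norm_num)) hy]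
    refine pd_eq_zero_of_eqOn_zero hΩ (fun z hz => ?_) hy j
    rw [pd_comm hΩ (hf.of_le (by norm_num)) hz]
    exact pd_eq_zero_of_eqOn_zero hΩ hi hz j
  have hwin : ∀ n, ∀ y ∈ Ω, pd i (pd n w) y = 0 := fun n y hy => by
    rw [pd_comm hΩ hw hy]
    exact pd_eq_zero_of_eqOn_zero hΩ hwi hy n
  have hwkk : ∀ y ∈ Ω, pd k (pd k w) y = 0 := fun y hy => by
    have hL' : ∀ z ∈ Ω, pd k (pd k f) z = -w z := fun z hz => by linarith [hL z hz]
    rw [pd_pd_pd_pd_comm hΩ hf j k hy,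
      pd_eq_of_eqOn hΩ (fun z hz => pd_eq_of_eqOn hΩ hL' hz j) hy,
      pd_eq_of_eqOn hΩ (fun z _ => pd_neg j) hy, pd_neg, h4 y hy, neg_zero]
  -- Here `w` is only `C²`, so `w_{jk}` is shown constant without a third derivative of `w`.
  obtain ⟨c₀, h0⟩ := exists_pd_pd_eq_const hΩ hc hw hcases hwi h4 hwkk
  obtain ⟨c₁, h1⟩ := exists_eq_polyFun_add_const (f := pd j w) hΩ hc
    ((hw1 j).differentiableOn (by norm_num)) (C c₀ * X k) fun n x hx => by
      rcases hcases n with rfl | rfl | rfl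
      · rw [hwin j x hx]
        simp [polyFun, *]
      · rw [h4 x hx]
        simp [polyFun, *]
      · rw [h0 x hx]
        simp [polyFun]
  obtain ⟨c₂, h2⟩ := exists_eq_polyFun_add_const (f := pd k w) hΩ hc
    ((hw1 k).differentiableOn (by norm_num)) (C c₀ * X j) fun n x hx => by
      rcases hcases n with rfl | rfl | rfl
      · rw [hwin k x hx]
        simp [polyFun, *]
      · rw [pd_comm hΩ hw hx, h0 x hx]
        simp [polyFun]
      · rw [hwkk x hx]
        simp [polyFun, *]
  obtain ⟨c₃, h3⟩ := exists_eq_polyFun_add_const (f := w) hΩ hc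
    (hw.differentiableOn (by norm_num)) (C c₀ * X j * X k + C c₁ * X j + C c₂ * X k)
    fun n x hx => by
      rcases hcases n with rfl | rfl | rfl
      · rw [hwi x hx]
        simp [polyFun, *]
      · rw [h1 x hx]
        simp [polyFun, *, mul_comm]
      · rw [h2 x hx]
        simp [polyFun, *]
  -- The divisors undo the factors that `∂_j²` produces on `harmonicPoly`.
  obtain ⟨c₄, c₅, c₆, c₇, h⟩ := exists_eq_harmonicPoly hΩ hc hf hij hik hjk hi hL (c₀ / 6) (c₁ / 6)
    (c₂ / 6) (c₃ / 2) fun x hx => by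
      refine (h3 x hx).trans ?_
      simp [polyFun, mul_div_cancel₀]
  exact ⟨_, h⟩

/-- The gradient of `f_{jj}` vanishes: its `k`-derivative is `f_{jjk}`, and by harmonicity its
`j`-derivative is `-f_{kkj}`. So `f_{jj}` is constant. -/
theorem exists_eq_harmonicPoly_of_pd_three (hΩ : IsOpen Ω) (hc : IsPreconnected Ω)
    (hf : ContDiffOn ℝ 4 f Ω) {i j k : Fin 3} (hij : i ≠ j) (hik : i ≠ k) (hjk : j ≠ k)
    (hi : ∀ x ∈ Ω, pd i f x = 0) (hL : ∀ x ∈ Ω, pd j (pd j f) x + pd k (pd k f) x = 0)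
    (hj : ∀ x ∈ Ω, pd j (pd k (pd j f)) x = 0) (hk : ∀ x ∈ Ω, pd k (pd j (pd k f)) x = 0) :
    ∃ c : Fin 8 → ℝ, c 0 = 0 ∧ c 1 = 0 ∧ c 2 = 0 ∧
      ∀ x ∈ Ω, f x = harmonicPoly c (x j) (x k) := by
  have hcases := eq_or_eq_or_eq_of_ne hij hik hjk
  have hf2 : ContDiffOn ℝ 2 f Ω := hf.of_le (by norm_num)
  have hC3 := fun n => contDiffOn_pd_three hΩ hf n
  have hC2 : ∀ n, ContDiffOn ℝ 2 (pd n f) Ω := fun n => (hC3 n).of_le (by norm_num)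
  have hL' : ∀ z ∈ Ω, pd j (pd j f) z = -pd k (pd k f) z := fun z hz => by linarith [hL z hz]
  obtain ⟨c₃, h3⟩ := exists_eq_const_of_pd_eq_zero (f := pd j (pd j f)) hΩ hc
    ((contDiffOn_pd_two hΩ (hC3 j) j).differentiableOn (by norm_num)) fun n x hx => by
      rcases hcases n with rfl | rfl | rfl
      · rw [pd_comm hΩ (hC2 j) hx]
        refine pd_eq_zero_of_eqOn_zero hΩ (fun z hz => ?_) hx j
        rw [pd_comm hΩ hf2 hz]
        exact pd_eq_zero_of_eqOn_zero hΩ hi hz j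
      · rw [pd_eq_of_eqOn hΩ hL' hx, pd_neg, pd_comm hΩ (hC2 k) hx,
          pd_eq_of_eqOn hΩ (fun y hy => pd_comm hΩ hf2 hy n k) hx,
          pd_eq_of_eqOn hΩ (fun y hy => pd_comm hΩ hf2 hy k n) hx, hk x hx, neg_zero]
      · rw [pd_comm hΩ (hC2 j) hx, hj x hx]
  obtain ⟨c₄, c₅, c₆, c₇, h⟩ := exists_eq_harmonicPoly hΩ hc hf hij hik hjk hi hL 0 0 0 (c₃ / 2)
    fun x hx => by
      rw [h3 x hx]
      simp [polyFun, mul_div_cancel₀]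
  exact ⟨_, rfl, rfl, rfl, h⟩

/-- A component of a universal displacement, with `i` the index of the component. -/
def componentPoly (i j k : Fin 3) (a b c d : ℝ) (h : Fin 8 → ℝ) : MvPolynomial (Fin 3) ℝ :=
  X i * (C (a / 2) * (X k ^ 2 - X j ^ 2) + C c * X k + C b * X j + C d)
    + harmonicPoly (fun n => C (h n)) (X j) (X k)

theorem polyFun_componentPoly (i j k : Fin 3) (a b c d : ℝ) (h : Fin 8 → ℝ) (x : E3) :
    polyFun (componentPoly i j k a b c d h) x = a / 2 * x i * (x k ^ 2 - x j ^ 2)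
      + c * x i * x k + b * x i * x j + d * x i + harmonicPoly h (x j) (x k) := by
  simp only [polyFun, componentPoly, harmonicPoly, map_add, map_sub, map_mul, map_pow, eval_X,
    eval_C, map_ofNat]
  ring

theorem exists_eq_componentPoly (hΩ : IsOpen Ω) (hc : IsPreconnected Ω)
    (hf : ContDiffOn ℝ 4 f Ω) {i j k : Fin 3} (hij : i ≠ j) (hik : i ≠ k) (hjk : j ≠ k)
    {a b c d : ℝ} (hi : ∀ x ∈ Ω, pd i f x
      = polyFun (C (a / 2) * (X k ^ 2 - X j ^ 2) + C c * X k + C b * X j + C d) x)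
    (hL : ∀ x ∈ Ω, pd j (pd j f) x + pd k (pd k f) x = 0) :
    ((∀ x ∈ Ω, pd j (pd j (pd j (pd j f))) x = 0) →
      ∃ h : Fin 8 → ℝ, ∀ x ∈ Ω, f x = polyFun (componentPoly i j k a b c d h) x) ∧
    ((∀ x ∈ Ω, pd j (pd k (pd j f)) x = 0) → (∀ x ∈ Ω, pd k (pd j (pd k f)) x = 0) →
      ∃ h : Fin 8 → ℝ, h 0 = 0 ∧ h 1 = 0 ∧ h 2 = 0 ∧
        ∀ x ∈ Ω, f x = polyFun (componentPoly i j k a b c d h) x) := by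
  have hij' := hij.symm
  have hik' := hik.symm
  have hjk' := hjk.symm
  set q : MvPolynomial (Fin 3) ℝ :=
    X i * (C (a / 2) * (X k ^ 2 - X j ^ 2) + C c * X k + C b * X j + C d) with hq
  have hd : ∀ {g : E3 → ℝ} {n : WithTop ℕ∞}, ContDiffOn ℝ n g Ω → n ≠ 0 →
      ∀ (p : MvPolynomial (Fin 3) ℝ) (m : Fin 3), ∀ x ∈ Ω,
        pd m (fun y => g y - polyFun p y) x = pd m g x - polyFun (pderiv m p) x :=
    fun hg hn p m x hx => by
      rw [pd_sub (differentiableAt_of_contDiffOn hΩ hg hn hx)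
        ((contDiff_polyFun (m := 1) p).differentiable one_ne_zero x), pd_polyFun]
  -- Subtracting `q` removes the dependence on `x_i`. The two `a`-terms of `q` cancel in the
  -- Laplacian over `j, k`, so harmonicity is kept.
  set v : E3 → ℝ := fun y => f y - polyFun q y
  have hv : ContDiffOn ℝ 4 v Ω := hf.sub (contDiff_polyFun q).contDiffOn
  have h1 : ∀ m, ∀ x ∈ Ω, pd m v x = pd m f x - polyFun (pderiv m q) x :=
    fun m x hx => hd hf (by norm_num) q m x hx
  have h2 : ∀ m n, ∀ x ∈ Ω, pd n (pd m v) x = pd n (pd m f) x - polyFun (pderiv n (pderiv m q)) x :=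
    fun m n x hx => by
      rw [pd_eq_of_eqOn hΩ (h1 m) hx,
        hd (contDiffOn_pd_three hΩ hf m) (by norm_num) _ n x hx]
  have h3 : ∀ m n p, ∀ x ∈ Ω, pd p (pd n (pd m v)) x
      = pd p (pd n (pd m f)) x - polyFun (pderiv p (pderiv n (pderiv m q))) x :=
    fun m n p x hx => by
      rw [pd_eq_of_eqOn hΩ (h2 m n) hx,
        hd (contDiffOn_pd_two hΩ (contDiffOn_pd_three hΩ hf m) n) (by norm_num) _ p x hx]
  have h4 : ∀ m n p r, ∀ x ∈ Ω, pd r (pd p (pd n (pd m v))) x = pd r (pd p (pd n (pd m f))) x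
      - polyFun (pderiv r (pderiv p (pderiv n (pderiv m q)))) x :=
    fun m n p r x hx => by
      rw [pd_eq_of_eqOn hΩ (h3 m n p) hx, hd (contDiffOn_pd_one hΩ (contDiffOn_pd_two hΩ
        (contDiffOn_pd_three hΩ hf m) n) p) (by norm_num) _ r x hx]
  have hvi : ∀ x ∈ Ω, pd i v x = 0 := fun x hx => by
    rw [h1 i x hx, hi x hx, sub_eq_zero, hq]
    simp [polyFun, *]
  have hvL : ∀ x ∈ Ω, pd j (pd j v) x + pd k (pd k v) x = 0 := fun x hx => by
    rw [h2 j j x hx, h2 k k x hx, sub_add_sub_comm, hL x hx, hq]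
    simp [polyFun, *]
  have hback : ∀ h : Fin 8 → ℝ, ∀ x, v x = harmonicPoly h (x j) (x k) →
      f x = polyFun (componentPoly i j k a b c d h) x := fun h x hx => by
    have : f x = v x + polyFun q x := by simp [v]
    rw [this, hx, polyFun_componentPoly, hq]
    simp [polyFun]
    ring
  constructor
  · intro hf4
    obtain ⟨h, hh⟩ := exists_eq_harmonicPoly_of_pd_four hΩ hc hv hij hik hjk hvi hvL
      fun x hx => by
        rw [h4 j j j j x hx, hf4 x hx, hq]
        simp [polyFun, *]
    exact ⟨h, fun x hx => hback h x (hh x hx)⟩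
  · intro hfj hfk
    obtain ⟨h, e0, e1, e2, hh⟩ := exists_eq_harmonicPoly_of_pd_three hΩ hc hv hij hik hjk hvi hvL
      (fun x hx => by
        rw [h3 j k j x hx, hfj x hx, hq]
        simp [polyFun, *])
      fun x hx => by
        rw [h3 k j k x hx, hfk x hx, hq]
        simp [polyFun, *]
    exact ⟨h, e0, e1, e2, fun x hx => hback h x (hh x hx)⟩

end HarmonicFields

/-! ### Universal displacements are polynomial fields. -/

section UniversalFields

variable {Ω : Set E3} {u : E3 → E3} {G : Subgroup O3} {x : E3}

/-- The polynomial displacement fields with components `componentPoly`. -/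
def IsPolynomialField (Ω : Set E3) (u : E3 → E3) (a a₁ b₁ c₁ d₁ d₂ d₃ : ℝ)
    (h₁ h₂ h₃ : Fin 8 → ℝ) : Prop :=
  ∀ x ∈ Ω, u x 0 = polyFun (componentPoly 0 1 2 a b₁ c₁ d₁ h₁) x ∧
    u x 1 = polyFun (componentPoly 1 0 2 (-a) a₁ (-c₁) d₂ h₂) x ∧
    u x 2 = polyFun (componentPoly 2 0 1 a (-a₁) (-b₁) d₃ h₃) x

/-- Applying `∂_j² = -∂_k²` twice gives `∂_j⁴ f = ∂_k⁴ f`. -/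
theorem pd_four_eq_zero_of_harmonic {f : E3 → ℝ} (hΩ : IsOpen Ω) (hf : ContDiffOn ℝ 4 f Ω)
    {j k : Fin 3} (hL : ∀ x ∈ Ω, pd j (pd j f) x + pd k (pd k f) x = 0)
    (hk : ∀ x ∈ Ω, pd k (pd k (pd k (pd k f))) x = 0) (hx : x ∈ Ω) :
    pd j (pd j (pd j (pd j f))) x = 0 := by
  have h1 : ∀ z ∈ Ω, pd j (pd j f) z = -pd k (pd k f) z := fun z hz => by linarith [hL z hz]
  have h2 : ∀ z ∈ Ω, pd k (pd k f) z = -pd j (pd j f) z := fun z hz => by linarith [hL z hz]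
  rw [pd_eq_of_eqOn hΩ (fun z hz => pd_eq_of_eqOn hΩ h1 hz j) hx,
    pd_eq_of_eqOn hΩ (fun z _ => pd_neg j) hx, pd_neg, pd_pd_pd_pd_comm hΩ hf k j hx,
    pd_eq_of_eqOn hΩ (fun z hz => pd_eq_of_eqOn hΩ h1 hz k) hx,
    pd_eq_of_eqOn hΩ (fun z _ => pd_neg k) hx, pd_neg, hk x hx, neg_zero, neg_zero]

theorem IsUniversalDisplacement.exists_pd_self (hΩ : IsOpen Ω) (hc : IsPreconnected Ω)
    (hu : IsUniversalDisplacement G Ω u) (hG : G ≤ signedCyclic ⊤) :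
    ∃ a a₁ b₁ c₁ d₁ d₂ d₃ : ℝ, ∀ x ∈ Ω,
      pd 0 (fun y => u y 0) x
        = polyFun (C (a / 2) * (X 2 ^ 2 - X 1 ^ 2) + C c₁ * X 2 + C b₁ * X 1 + C d₁) x ∧
      pd 1 (fun y => u y 1) x
        = polyFun (C (-a / 2) * (X 2 ^ 2 - X 0 ^ 2) + C (-c₁) * X 2 + C a₁ * X 0 + C d₂) x ∧
      pd 2 (fun y => u y 2) x
        = polyFun (C (a / 2) * (X 1 ^ 2 - X 0 ^ 2) + C (-b₁) * X 1 + C (-a₁) * X 0 + C d₃) x := by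
  have hU := fun l => contDiffOn_component hu.1 l
  have hU2 : ∀ l, ContDiffOn ℝ 2 (fun y => u y l) Ω := fun l => (hU l).of_le (by norm_num)
  have hU' := fun l m => contDiffOn_pd_three hΩ (hU l) m
  have hU'2 : ∀ l m, ContDiffOn ℝ 2 (pd m fun y => u y l) Ω :=
    fun l m => (hU' l m).of_le (by norm_num)
  have hself := fun k (x : E3) (hx : x ∈ Ω) => hu.pd_pd_self hΩ hG k hx
  have hdiv := fun k (x : E3) (hx : x ∈ Ω) => hu.pd_div hΩ hG k hx
  have hlap := fun k (x : E3) (hx : x ∈ Ω) => hu.sum_pd_pd hΩ hG k hx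
  simp only [Fin.sum_univ_three] at hdiv hlap
  -- By the divergence relations, `α`, `β` and `γ` determine, up to sign, all mixed derivatives
  -- `u_{i,ij}`. They turn out to depend only on `x 0`, `x 1` and `x 2` respectively.
  set α := pd 0 (pd 1 fun y => u y 1) with hα
  set β := pd 1 (pd 0 fun y => u y 0) with hβ
  set γ := pd 2 (pd 0 fun y => u y 0) with hγ
  have hα' : ∀ y ∈ Ω, α y = -pd 0 (pd 2 fun y => u y 2) y := fun y hy => by
    linarith [hdiv 0 y hy, hself 0 y hy]
  have hβ' : ∀ y ∈ Ω, β y = -pd 1 (pd 2 fun y => u y 2) y := fun y hy => by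
    linarith [hdiv 1 y hy, hself 1 y hy]
  have hγ' : ∀ y ∈ Ω, γ y = -pd 2 (pd 1 fun y => u y 1) y := fun y hy => by
    linarith [hdiv 2 y hy, hself 2 y hy]
  have hα2 : ContDiffOn ℝ 2 α Ω := contDiffOn_pd_two hΩ (hU' 1 1) 0
  have hβ2 : ContDiffOn ℝ 2 β Ω := contDiffOn_pd_two hΩ (hU' 0 0) 1
  have hγ2 : ContDiffOn ℝ 2 γ Ω := contDiffOn_pd_two hΩ (hU' 0 0) 2
  have h3 : ∀ l p, ∀ y ∈ Ω, _ := fun l p y hy =>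
    pd_pd_pd_eq_zero hΩ ((hU l).of_le (by norm_num)) (hself l) p hy
  have hβ0 : ∀ y ∈ Ω, pd 0 β y = 0 := fun y hy => (h3 0 1 y hy).2.1
  have hγ0 : ∀ y ∈ Ω, pd 0 γ y = 0 := fun y hy => (h3 0 2 y hy).2.1
  have hα1 : ∀ y ∈ Ω, pd 1 α y = 0 := fun y hy => (h3 1 0 y hy).2.1
  have hβ2' : ∀ y ∈ Ω, pd 2 β y = 0 := fun y hy => by
    rw [pd_eq_of_eqOn hΩ hβ' hy, pd_neg, (h3 2 1 y hy).2.1, neg_zero]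
  have hα2' : ∀ y ∈ Ω, pd 2 α y = 0 := fun y hy => by
    rw [pd_eq_of_eqOn hΩ hα' hy, pd_neg, (h3 2 0 y hy).2.1, neg_zero]
  have hγ1 : ∀ y ∈ Ω, pd 1 γ y = 0 := fun y hy => by
    rw [pd_eq_of_eqOn hΩ hγ' hy, pd_neg, (h3 1 2 y hy).2.1, neg_zero]
  -- The harmonicity relation for `u_0`, differentiated in `x 0`, links the slopes of `β` and `γ`;
  -- the one for `u_1`, differentiated in `x 1`, links those of `α` and `γ`.
  have hβγ : ∀ y ∈ Ω, pd 1 β y = -pd 2 γ y := fun y hy => by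
    have hz : ∀ z ∈ Ω, pd 1 (pd 1 fun y => u y 0) z = -pd 2 (pd 2 fun y => u y 0) z :=
      fun z hz => by linarith [hlap 0 z hz, hself 0 z hz]
    rw [hβ, hγ, pd_eq_of_eqOn hΩ (fun z hz => pd_comm hΩ (hU2 0) hz 1 0) hy,
      pd_comm hΩ (hU'2 0 1) hy, pd_eq_of_eqOn hΩ hz hy, pd_neg, pd_comm hΩ (hU'2 0 2) hy,
      pd_eq_of_eqOn hΩ (fun z hz => pd_comm hΩ (hU2 0) hz 0 2) hy]
  have hαγ : ∀ y ∈ Ω, pd 0 α y = pd 2 γ y := fun y hy => by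
    have hz : ∀ z ∈ Ω, pd 0 (pd 0 fun y => u y 1) z = -pd 2 (pd 2 fun y => u y 1) z :=
      fun z hz => by linarith [hlap 1 z hz, hself 1 z hz]
    rw [pd_eq_of_eqOn hΩ hγ' hy, pd_neg, hα,
      pd_eq_of_eqOn hΩ (fun z hz => pd_comm hΩ (hU2 1) hz 0 1) hy,
      pd_comm hΩ (hU'2 1 0) hy, pd_eq_of_eqOn hΩ hz hy, pd_neg, pd_comm hΩ (hU'2 1 2) hy,
      pd_eq_of_eqOn hΩ (fun z hz => pd_comm hΩ (hU2 1) hz 1 2) hy]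
  -- A function of `x 2` alone that equals a function of `x 0` alone is constant.
  obtain ⟨a, ha⟩ := exists_eq_const_of_pd_eq_zero (f := pd 2 γ) hΩ hc
    ((contDiffOn_pd_one hΩ hγ2 2).differentiableOn (by norm_num)) fun n x hx => by
      fin_cases n
      · exact (pd_comm hΩ hγ2 hx _ _).trans (pd_eq_zero_of_eqOn_zero hΩ hγ0 hx _)
      · exact (pd_comm hΩ hγ2 hx _ _).trans (pd_eq_zero_of_eqOn_zero hΩ hγ1 hx _)
      · exact (pd_eq_of_eqOn hΩ (fun z hz => (hαγ z hz).symm) hx _).trans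
          ((pd_comm hΩ hα2 hx _ _).trans (pd_eq_zero_of_eqOn_zero hΩ hα2' hx _))
  obtain ⟨c₁, hc₁⟩ := exists_eq_polyFun_add_const hΩ hc (hγ2.differentiableOn (by norm_num))
    (C a * X 2) fun n x hx => by
      fin_cases n
      · simpa [polyFun] using hγ0 x hx
      · simpa [polyFun] using hγ1 x hx
      · simpa [polyFun] using ha x hx
  obtain ⟨b₁, hb₁⟩ := exists_eq_polyFun_add_const hΩ hc (hβ2.differentiableOn (by norm_num))
    (C (-a) * X 1) fun n x hx => by
      fin_cases n
      · simpa [polyFun] using hβ0 x hx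
      · simpa [polyFun, ha x hx] using hβγ x hx
      · simpa [polyFun] using hβ2' x hx
  obtain ⟨a₁, ha₁⟩ := exists_eq_polyFun_add_const hΩ hc (hα2.differentiableOn (by norm_num))
    (C a * X 0) fun n x hx => by
      fin_cases n
      · simpa [polyFun, ha x hx] using hαγ x hx
      · simpa [polyFun] using hα1 x hx
      · simpa [polyFun] using hα2' x hx
  obtain ⟨d₁, hd₁⟩ := exists_eq_polyFun_add_const hΩ hc ((hU' 0 0).differentiableOn (by norm_num))
    (C (a / 2) * (X 2 ^ 2 - X 1 ^ 2) + C c₁ * X 2 + C b₁ * X 1) fun n x hx => by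
      fin_cases n
      · simpa [polyFun] using hself 0 x hx
      · refine (hb₁ x hx).trans ?_
        simp [polyFun]
        ring
      · refine (hc₁ x hx).trans ?_
        simp [polyFun]
        ring
  obtain ⟨d₂, hd₂⟩ := exists_eq_polyFun_add_const hΩ hc ((hU' 1 1).differentiableOn (by norm_num))
    (C (-a / 2) * (X 2 ^ 2 - X 0 ^ 2) + C (-c₁) * X 2 + C a₁ * X 0) fun n x hx => by
      fin_cases n
      · refine (ha₁ x hx).trans ?_
        simp [polyFun]
        ring
      · simpa [polyFun] using hself 1 x hx
      · refine (neg_eq_iff_eq_neg.2 (hγ' x hx)).symm.trans ?_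
        rw [hc₁ x hx]
        simp [polyFun]
        ring
  obtain ⟨d₃, hd₃⟩ := exists_eq_polyFun_add_const hΩ hc ((hU' 2 2).differentiableOn (by norm_num))
    (C (a / 2) * (X 1 ^ 2 - X 0 ^ 2) + C (-b₁) * X 1 + C (-a₁) * X 0) fun n x hx => by
      fin_cases n
      · refine (neg_eq_iff_eq_neg.2 (hα' x hx)).symm.trans ?_
        rw [ha₁ x hx]
        simp [polyFun]
        ring
      · refine (neg_eq_iff_eq_neg.2 (hβ' x hx)).symm.trans ?_
        rw [hb₁ x hx]
        simp [polyFun]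
        ring
      · simpa [polyFun] using hself 2 x hx
  exact ⟨a, a₁, b₁, c₁, d₁, d₂, d₃, fun x hx => ⟨hd₁ x hx, hd₂ x hx, hd₃ x hx⟩⟩

theorem IsUniversalDisplacement.exists_isPolynomialField (hΩ : IsOpen Ω) (hc : IsPreconnected Ω)
    (hu : IsUniversalDisplacement G Ω u) (hG : G ≤ signedCyclic ⊤) :
    ∃ (a a₁ b₁ c₁ d₁ d₂ d₃ : ℝ) (h₁ h₂ h₃ : Fin 8 → ℝ),
      (G ≤ signedCyclic ⊥ → ∀ n < 3, h₁ n = 0 ∧ h₂ n = 0 ∧ h₃ n = 0) ∧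
      IsPolynomialField Ω u a a₁ b₁ c₁ d₁ d₂ d₃ h₁ h₂ h₃ := by
  obtain ⟨a, a₁, b₁, c₁, d₁, d₂, d₃, h⟩ := hu.exists_pd_self hΩ hc hG
  have hU := fun l => contDiffOn_component hu.1 l
  have hself := fun k (x : E3) (hx : x ∈ Ω) => hu.pd_pd_self hΩ hG k hx
  have hlap := fun k (x : E3) (hx : x ∈ Ω) => hu.sum_pd_pd hΩ hG k hx
  simp only [Fin.sum_univ_three] at hlap
  have e1 := exists_eq_componentPoly (i := 0) (j := 1) (k := 2) hΩ hc (hU 0) (by decide)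
    (by decide) (by decide) (fun x hx => (h x hx).1)
    fun x hx => by linarith [hself 0 x hx, hlap 0 x hx]
  have hL1 : ∀ x ∈ Ω, pd 0 (pd 0 fun y => u y 1) x + pd 2 (pd 2 fun y => u y 1) x = 0 :=
    fun x hx => by linarith [hself 1 x hx, hlap 1 x hx]
  have e2 := exists_eq_componentPoly (i := 1) (j := 0) (k := 2) hΩ hc (hU 1) (by decide)
    (by decide) (by decide) (fun x hx => (h x hx).2.1) hL1
  have e3 := exists_eq_componentPoly (i := 2) (j := 0) (k := 1) hΩ hc (hU 2) (by decide)
    (by decide) (by decide) (fun x hx => (h x hx).2.2)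
    fun x hx => by linarith [hself 2 x hx, hlap 2 x hx]
  by_cases hT : G ≤ signedCyclic ⊥
  · have h3 := fun {i j k : Fin 3} (hij : i ≠ j) (hik : i ≠ k) (hjk : j ≠ k) (x : E3)
      (hx : x ∈ Ω) => hu.pd_three hΩ hT hij hik hjk hx
    obtain ⟨h₁, e10, e11, e12, e1⟩ := e1.2 (h3 (by decide) (by decide) (by decide))
      (h3 (by decide) (by decide) (by decide))
    obtain ⟨h₂, e20, e21, e22, e2⟩ := e2.2 (h3 (by decide) (by decide) (by decide))
      (h3 (by decide) (by decide) (by decide))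
    obtain ⟨h₃, e30, e31, e32, e3⟩ := e3.2 (h3 (by decide) (by decide) (by decide))
      (h3 (by decide) (by decide) (by decide))
    refine ⟨a, a₁, b₁, c₁, d₁, d₂, d₃, h₁, h₂, h₃, fun _ n hn => ?_,
      fun x hx => ⟨e1 x hx, e2 x hx, e3 x hx⟩⟩
    obtain rfl | rfl | rfl : n = 0 ∨ n = 1 ∨ n = 2 := by decide +revert
    exacts [⟨e10, e20, e30⟩, ⟨e11, e21, e31⟩, ⟨e12, e22, e32⟩]
  · have h4 := fun (k : Fin 3) (x : E3) (hx : x ∈ Ω) => hu.pd_four hΩ hG k hx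
    obtain ⟨h₁, e1⟩ := e1.1 (h4 0)
    -- For component `1` the test material controls `∂_2⁴`, whereas `j = 0` in this case;
    -- harmonicity exchanges the two.
    obtain ⟨h₂, e2⟩ := e2.1 fun x hx => pd_four_eq_zero_of_harmonic hΩ (hU 1) hL1 (h4 1) hx
    obtain ⟨h₃, e3⟩ := e3.1 (h4 2)
    exact ⟨a, a₁, b₁, c₁, d₁, d₂, d₃, h₁, h₂, h₃, fun h => absurd h hT,
      fun x hx => ⟨e1 x hx, e2 x hx, e3 x hx⟩⟩

end UniversalFields

/-! ### Index parity of the derivatives of the polynomial components. -/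

section Parity

/-- The diagonal entries of the rotation by `π` about the `a`-th axis. -/
def axisSign (a i : Fin 3) : ℤ := if i = a then 1 else -1

theorem axisSign_mul_self (a i : Fin 3) : axisSign a i * axisSign a i = 1 := by
  decide +revert

theorem axisSign_mul_mul {i j k : Fin 3} (hij : i ≠ j) (hik : i ≠ k) (hjk : j ≠ k) (a : Fin 3) :
    axisSign a i * axisSign a j * axisSign a k = 1 := by
  decide +revert

theorem pderiv_pderiv_componentPoly {i j k : Fin 3} (hij : i ≠ j) (hik : i ≠ k) (hjk : j ≠ k)
    (a b c d : ℝ) (h : Fin 8 → ℝ) :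
    let P := componentPoly i j k a b c d h
    pderiv i (pderiv i P) = 0 ∧ pderiv i (pderiv j P) = C b - C a * X j ∧
    pderiv i (pderiv k P) = C c + C a * X k ∧
    pderiv j (pderiv i P) = C b - C a * X j ∧
    pderiv j (pderiv j P) = C (h 0) * (6 * X j * X k) + C (h 1) * (6 * X j) + C (h 2) * (6 * X k)
      + 2 * C (h 3) - C a * X i ∧
    pderiv j (pderiv k P) = C (h 0) * (3 * X j ^ 2 - 3 * X k ^ 2) - C (h 1) * (6 * X k)
      + C (h 2) * (6 * X j) + C (h 4) ∧
    pderiv k (pderiv i P) = C c + C a * X k ∧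
    pderiv k (pderiv j P) = C (h 0) * (3 * X j ^ 2 - 3 * X k ^ 2) - C (h 1) * (6 * X k)
      + C (h 2) * (6 * X j) + C (h 4) ∧
    pderiv k (pderiv k P) = -(C (h 0) * (6 * X j * X k) + C (h 1) * (6 * X j)
      + C (h 2) * (6 * X k) + 2 * C (h 3)) + C a * X i := by
  have hij' := hij.symm
  have hik' := hik.symm
  have hjk' := hjk.symm
  have hC : (C (a / 2) : MvPolynomial (Fin 3) ℝ) * 2 = C a := by
    rw [← map_ofNat (C : ℝ →+* MvPolynomial (Fin 3) ℝ), ← C_mul]; simp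
  intro P
  have h1 : pderiv i P = C (a / 2) * (X k ^ 2 - X j ^ 2) + C c * X k + C b * X j + C d := by
    simp [P, componentPoly, harmonicPoly, *]
  have h2 : pderiv j P = X i * (C b - C a * X j) + (C (h 0) * (3 * X j ^ 2 * X k - X k ^ 3)
      + C (h 1) * (3 * X j ^ 2 - 3 * X k ^ 2) + C (h 2) * (6 * X j * X k) + C (h 3) * (2 * X j)
      + C (h 4) * X k + C (h 5)) := by
    simp [P, componentPoly, harmonicPoly, *]
    linear_combination (-X i * X j) * hC
  have h3 : pderiv k P = X i * (C c + C a * X k) + (C (h 0) * (X j ^ 3 - 3 * X j * X k ^ 2)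
      - C (h 1) * (6 * X j * X k) + C (h 2) * (3 * X j ^ 2 - 3 * X k ^ 2) - C (h 3) * (2 * X k)
      + C (h 4) * X j + C (h 6)) := by
    simp [P, componentPoly, harmonicPoly, *]
    linear_combination (X i * X k) * hC
  rw [h1, h2, h3]
  refine ⟨?_, ?_, ?_, ?_, ?_, ?_, ?_, ?_, ?_⟩ <;> simp [*] <;>
    first
      | done
      | ring1
      | linear_combination (-X j) * hC
      | linear_combination (X k) * hC

/-- The only quartic part is `x_j³ x_k - x_j x_k³`. Its nonzero fourth derivatives carry `j, j, j,
k` or `j, k, k, k`; together with `i` this is one copy of `i, j, k` and a repeated index. -/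
theorem pderiv_four_componentPoly {i j k : Fin 3} (hij : i ≠ j) (hik : i ≠ k) (hjk : j ≠ k)
    (a b c d : ℝ) (h : Fin 8 → ℝ) (p q r s : Fin 3) :
    pderiv p (pderiv q (pderiv r (pderiv s (componentPoly i j k a b c d h)))) = 0 ∨
      ∀ e, axisSign e i * axisSign e p * axisSign e q * axisSign e r * axisSign e s = 1 := by
  have hij' := hij.symm
  have hik' := hik.symm
  have hjk' := hjk.symm
  have hcases := eq_or_eq_or_eq_of_ne hij hik hjk
  obtain ⟨h1, h2, h3, h4, h5, h6, h7, h8, h9⟩ := pderiv_pderiv_componentPoly hij hik hjk a b c d h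
  have hs := axisSign_mul_mul hij hik hjk
  rcases hcases r with hr | hr | hr <;> rcases hcases s with hs' | hs' | hs' <;>
    rw [hr, hs'] <;> simp only [h1, h2, h3, h4, h5, h6, h7, h8, h9] <;>
    rcases hcases p with hp | hp | hp <;> rcases hcases q with hq | hq | hq <;> rw [hp, hq] <;>
    first
      | (refine Or.inr fun e => ?_
         linear_combination (axisSign e j * axisSign e j) * hs e + axisSign_mul_self e j)
      | (refine Or.inr fun e => ?_
         linear_combination (axisSign e k * axisSign e k) * hs e + axisSign_mul_self e k)
      | (left; simp [hij, hik, hjk, hij', hik', hjk'])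

/-- Without the first three coefficients of `h` the only cubic part is the `a`-term, whose nonzero
third derivatives carry `i, j, j` or `i, k, k`; with the component index `i` all indices occur in
pairs. -/
theorem pderiv_three_componentPoly {i j k : Fin 3} (hij : i ≠ j) (hik : i ≠ k) (hjk : j ≠ k)
    (a b c d : ℝ) {h : Fin 8 → ℝ} (h0 : h 0 = 0) (h1 : h 1 = 0) (h2 : h 2 = 0) (p q r : Fin 3) :
    pderiv p (pderiv q (pderiv r (componentPoly i j k a b c d h))) = 0 ∨
      ∀ e, axisSign e i * axisSign e p * axisSign e q * axisSign e r = 1 := by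
  have hij' := hij.symm
  have hik' := hik.symm
  have hjk' := hjk.symm
  have hcases := eq_or_eq_or_eq_of_ne hij hik hjk
  obtain ⟨e1, e2, e3, e4, e5, e6, e7, e8, e9⟩ := pderiv_pderiv_componentPoly hij hik hjk a b c d h
  have hs := axisSign_mul_self
  rcases hcases q with hq | hq | hq <;> rcases hcases r with hr | hr | hr <;>
    rw [hq, hr] <;> simp only [e1, e2, e3, e4, e5, e6, e7, e8, e9] <;>
    rcases hcases p with hp | hp | hp <;> rw [hp] <;>
    first
      | (refine Or.inr fun e => ?_
         linear_combination (axisSign e j * axisSign e j) * hs e i + hs e j)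
      | (refine Or.inr fun e => ?_
         linear_combination (axisSign e k * axisSign e k) * hs e i + hs e k)
      | (left; simp [hij, hik, hjk, hij', hik', hjk', h0, h1, h2])

end Parity

/-! ### Consequences of invariance for arbitrary moduli. -/

section InvariantModuli

variable {L : Moduli}

/-- The shift moves axis `e` to axis `2`, so conjugating `halfTurn` by the threefold rotation yields
the half-turns about all axes. -/
theorem axisSign_add (e i : Fin 3) :
    (((![-1, -1, 1] : Fin 3 → ℤˣ) (i + (2 - e)) : ℤ) : ℝ) = axisSign e i := by
  have : ((![-1, -1, 1] : Fin 3 → ℤˣ) (i + (2 - e)) : ℤ) = axisSign e i := by decide +revert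
  rw [this]

theorem C_add (hR : thirdTurn ∈ L.sym) (c i j k l : Fin 3) :
    L.C (i + c) (j + c) (k + c) (l + c) = L.C i j k l := by
  have h : ∀ i j k l, L.C (i + 2) (j + 2) (k + 2) (l + 2) = L.C i j k l := by
    simpa using (mem_symC_iff thirdTurn_apply).1 hR.2
  obtain rfl | rfl | rfl : c = 0 ∨ c = 2 ∨ c = 2 + 2 := by decide +revert
  · simp
  · exact h i j k l
  · simp only [← add_assoc, h]

theorem M_add (hR : thirdTurn ∈ L.sym) (c i j k l m : Fin 3) :
    L.M (i + c) (j + c) (k + c) (l + c) (m + c) = L.M i j k l m := by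
  have h : ∀ i j k l m, L.M (i + 2) (j + 2) (k + 2) (l + 2) (m + 2) = L.M i j k l m := by
    simpa using (mem_symM_iff thirdTurn_apply).1 hR.1.2
  obtain rfl | rfl | rfl : c = 0 ∨ c = 2 ∨ c = 2 + 2 := by decide +revert
  · simp
  · exact h i j k l m
  · simp only [← add_assoc, h]

theorem A_add (hR : thirdTurn ∈ L.sym) (c i j k l m n : Fin 3) :
    L.A (i + c) (j + c) (k + c) (l + c) (m + c) (n + c) = L.A i j k l m n := by
  have h : ∀ i j k l m n,
      L.A (i + 2) (j + 2) (k + 2) (l + 2) (m + 2) (n + 2) = L.A i j k l m n := by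
    simpa using (mem_symA_iff thirdTurn_apply).1 hR.1.1
  obtain rfl | rfl | rfl : c = 0 ∨ c = 2 ∨ c = 2 + 2 := by decide +revert
  · simp
  · exact h i j k l m n
  · simp only [← add_assoc, h]

theorem axisSign_mul_C (hH : halfTurn ∈ L.sym) (hR : thirdTurn ∈ L.sym) (e i j k l : Fin 3) :
    (axisSign e i : ℝ) * axisSign e j * axisSign e k * axisSign e l * L.C i j k l
      = L.C i j k l := by
  have h := (mem_symC_iff halfTurn_apply).1 hH.2 (i + (2 - e)) (j + (2 - e)) (k + (2 - e))
    (l + (2 - e))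
  simpa only [axisSign_add, add_zero, C_add hR] using h

theorem axisSign_mul_M (hH : halfTurn ∈ L.sym) (hR : thirdTurn ∈ L.sym) (e i j k l m : Fin 3) :
    (axisSign e i : ℝ) * axisSign e j * axisSign e k * axisSign e l * axisSign e m * L.M i j k l m
      = L.M i j k l m := by
  have h := (mem_symM_iff halfTurn_apply).1 hH.1.2 (i + (2 - e)) (j + (2 - e)) (k + (2 - e))
    (l + (2 - e)) (m + (2 - e))
  simpa only [axisSign_add, add_zero, M_add hR] using h

theorem axisSign_mul_A (hH : halfTurn ∈ L.sym) (hR : thirdTurn ∈ L.sym) (e i j k l m n : Fin 3) :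
    (axisSign e i : ℝ) * axisSign e j * axisSign e k * axisSign e l * axisSign e m * axisSign e n
      * L.A i j k l m n = L.A i j k l m n := by
  have h := (mem_symA_iff halfTurn_apply).1 hH.1.1 (i + (2 - e)) (j + (2 - e)) (k + (2 - e))
    (l + (2 - e)) (m + (2 - e)) (n + (2 - e))
  simpa only [axisSign_add, add_zero, A_add hR] using h

theorem M_eq_zero_of_neg_one_mem (h : (-1 : O3) ∈ L.sym) (i j k l m : Fin 3) :
    L.M i j k l m = 0 := by
  have := (mem_symM_iff neg_one_apply).1 h.1.2 i j k l m
  simp at this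
  linarith

/-- The half-turn about axis `k + 1` changes the sign of the index `k`, and the other five signs
cancel, so the component equals its negative. -/
theorem A_eq_zero (hH : halfTurn ∈ L.sym) (hR : thirdTurn ∈ L.sym) {i j k l m n : Fin 3}
    (h : ∀ e, axisSign e i * axisSign e j * axisSign e l * axisSign e m * axisSign e n = 1) :
    L.A i j k l m n = 0 := by
  have h1 := axisSign_mul_A hH hR (k + 1) i j k l m n
  have h2 : ((axisSign (k + 1) i * axisSign (k + 1) j * axisSign (k + 1) l * axisSign (k + 1) m
    * axisSign (k + 1) n : ℤ) : ℝ) = 1 := by exact_mod_cast h (k + 1)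
  have h3 : (axisSign (k + 1) k : ℝ) = -1 := by simp [axisSign]
  push_cast at h2
  rw [h3] at h1
  linear_combination (-1 / 2) * L.A i j k l m n * h2 - h1 / 2

theorem M_eq_zero (hH : halfTurn ∈ L.sym) (hR : thirdTurn ∈ L.sym) {i j k l m : Fin 3}
    (h : ∀ e, axisSign e i * axisSign e k * axisSign e l * axisSign e m = 1) :
    L.M i j k l m = 0 := by
  have h1 := axisSign_mul_M hH hR (j + 1) i j k l m
  have h2 : ((axisSign (j + 1) i * axisSign (j + 1) k * axisSign (j + 1) l * axisSign (j + 1) m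
    : ℤ) : ℝ) = 1 := by exact_mod_cast h (j + 1)
  have h3 : (axisSign (j + 1) j : ℝ) = -1 := by simp [axisSign]
  push_cast at h2
  rw [h3] at h1
  linear_combination (-1 / 2) * L.M i j k l m * h2 - h1 / 2

theorem M_eq_zero' (hH : halfTurn ∈ L.sym) (hR : thirdTurn ∈ L.sym) {i j k l m : Fin 3}
    (h : ∀ e, axisSign e i * axisSign e j * axisSign e k * axisSign e l = 1) :
    L.M i j k l m = 0 := by
  have h1 := axisSign_mul_M hH hR (m + 1) i j k l m
  have h2 : ((axisSign (m + 1) i * axisSign (m + 1) j * axisSign (m + 1) k * axisSign (m + 1) l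
    : ℤ) : ℝ) = 1 := by exact_mod_cast h (m + 1)
  have h3 : (axisSign (m + 1) m : ℝ) = -1 := by simp [axisSign]
  push_cast at h2
  rw [h3] at h1
  linear_combination (-1 / 2) * L.M i j k l m * h2 - h1 / 2

set_option synthInstance.maxSize 2000 in
set_option synthInstance.maxHeartbeats 200000 in
-- Either some half-turn reverses the sign of the component, or the four indices are all equal or
-- form two pairs. Two distinct indices are always `c` and `c + 1` in some order.
theorem index_cases (i j k l : Fin 3) :
    ((∃ e, axisSign e i * axisSign e j * axisSign e k * axisSign e l = -1) ∧ ¬(i = j ∧ k = l) ∧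
      ¬(i ≠ j ∧ (i = k ∧ j = l ∨ i = l ∧ j = k))) ∨
    (∃ c, i = c ∧ j = c ∧ k = c ∧ l = c) ∨
    ∃ c, (i = c ∧ j = c ∧ k = c + 1 ∧ l = c + 1) ∨ (i = c + 1 ∧ j = c + 1 ∧ k = c ∧ l = c) ∨
      (i = c ∧ j = c + 1 ∧ k = c ∧ l = c + 1) ∨ (i = c ∧ j = c + 1 ∧ k = c + 1 ∧ l = c) ∨
      (i = c + 1 ∧ j = c ∧ k = c ∧ l = c + 1) ∨ (i = c + 1 ∧ j = c ∧ k = c + 1 ∧ l = c) := by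
  decide +revert

/-- The fourth-order tensor of a solid of cubic symmetry. -/
theorem C_eq (hH : halfTurn ∈ L.sym) (hR : thirdTurn ∈ L.sym) (i j k l : Fin 3) :
    L.C i j k l = (if i = j ∧ k = l then if i = k then L.C 0 0 0 0 else L.C 0 0 1 1 else 0)
      + (if i ≠ j ∧ (i = k ∧ j = l ∨ i = l ∧ j = k) then L.C 0 1 0 1 else 0) := by
  have h1 : ∀ c, L.C c c c c = L.C 0 0 0 0 := fun c => by simpa using C_add hR c 0 0 0 0
  have h2 : ∀ c, L.C c c (c + 1) (c + 1) = L.C 0 0 1 1 := fun c => by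
    simpa [add_comm] using C_add hR c 0 0 1 1
  have h3 : ∀ c, L.C c (c + 1) c (c + 1) = L.C 0 1 0 1 := fun c => by
    simpa [add_comm] using C_add hR c 0 1 0 1
  have h4 : ∀ c, L.C (c + 1) c c (c + 1) = L.C 0 1 0 1 := fun c => by rw [L.C_minor, h3]
  have h5 : ∀ c, L.C c (c + 1) (c + 1) c = L.C 0 1 0 1 := fun c => by rw [L.C_major, h4]
  rcases index_cases i j k l with ⟨⟨e, he⟩, hn1, hn2⟩ | ⟨c, rfl, rfl, rfl, rfl⟩ |
    ⟨c, ⟨rfl, rfl, rfl, rfl⟩ | ⟨rfl, rfl, rfl, rfl⟩ | ⟨rfl, rfl, rfl, rfl⟩ | ⟨rfl, rfl, rfl, rfl⟩ |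
      ⟨rfl, rfl, rfl, rfl⟩ | ⟨rfl, rfl, rfl, rfl⟩⟩
  · rw [if_neg hn1, if_neg hn2]
    have h := axisSign_mul_C hH hR e i j k l
    have he' : ((axisSign e i * axisSign e j * axisSign e k * axisSign e l : ℤ) : ℝ) = -1 := by
      rw [he]; norm_num
    push_cast at he'
    rw [he'] at h
    linarith
  · simp [h1]
  · simp [h2]
  · rw [L.C_major]
    simp [h2]
  · simp [h3]
  · simp [h5]
  · simp [h4]
  · rw [L.C_minor]
    simp [h5]

theorem sum_C_eq (hH : halfTurn ∈ L.sym) (hR : thirdTurn ∈ L.sym) (k : Fin 3)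
    (E : Fin 3 → Fin 3 → Fin 3 → ℝ) (hE : ∀ i l m, E i l m = E i m l) :
    ∑ i, ∑ l, ∑ m, L.C i k l m * E i l m = L.C 0 0 0 0 * E k k k
      + L.C 0 0 1 1 * (∑ l, E k l l - E k k k) + 2 * L.C 0 1 0 1 * (∑ i, E i k i - E k k k) := by
  have h := C_eq hH hR
  generalize L.C 0 0 0 0 = p, L.C 0 0 1 1 = q, L.C 0 1 0 1 = r at h
  simp only [h, Fin.sum_univ_three]
  obtain rfl | rfl | rfl : k = 0 ∨ k = 1 ∨ k = 2 := by decide +revert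
  all_goals
    simp
    grind

end InvariantModuli

/-! ### The polynomial fields are universal. -/

section PolynomialFields

variable {Ω : Set E3} {u : E3 → E3} {x : E3}

/-- The polynomials of the components of an `IsPolynomialField`. -/
def fieldPoly (a a₁ b₁ c₁ d₁ d₂ d₃ : ℝ) (h₁ h₂ h₃ : Fin 8 → ℝ) : Fin 3 → MvPolynomial (Fin 3) ℝ :=
  ![componentPoly 0 1 2 a b₁ c₁ d₁ h₁, componentPoly 1 0 2 (-a) a₁ (-c₁) d₂ h₂,
    componentPoly 2 0 1 a (-a₁) (-b₁) d₃ h₃]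

theorem pderiv_four_fieldPoly (a a₁ b₁ c₁ d₁ d₂ d₃ : ℝ) (h₁ h₂ h₃ : Fin 8 → ℝ)
    (l p q r s : Fin 3) :
    pderiv p (pderiv q (pderiv r (pderiv s (fieldPoly a a₁ b₁ c₁ d₁ d₂ d₃ h₁ h₂ h₃ l)))) = 0 ∨
      ∀ e, axisSign e l * axisSign e p * axisSign e q * axisSign e r * axisSign e s = 1 := by
  fin_cases l <;> exact pderiv_four_componentPoly (by decide) (by decide) (by decide) ..

theorem pderiv_three_fieldPoly (a a₁ b₁ c₁ d₁ d₂ d₃ : ℝ) {h₁ h₂ h₃ : Fin 8 → ℝ}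
    (h : ∀ n < 3, h₁ n = 0 ∧ h₂ n = 0 ∧ h₃ n = 0) (l p q r : Fin 3) :
    pderiv p (pderiv q (pderiv r (fieldPoly a a₁ b₁ c₁ d₁ d₂ d₃ h₁ h₂ h₃ l))) = 0 ∨
      ∀ e, axisSign e l * axisSign e p * axisSign e q * axisSign e r = 1 := by
  have e0 := h 0 (by decide)
  have e1 := h 1 (by decide)
  have e2 := h 2 (by decide)
  fin_cases l
  · exact pderiv_three_componentPoly (by decide) (by decide) (by decide) _ _ _ _ e0.1 e1.1 e2.1 ..
  · exact pderiv_three_componentPoly (by decide) (by decide) (by decide) _ _ _ _ e0.2.1 e1.2.1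
      e2.2.1 ..
  · exact pderiv_three_componentPoly (by decide) (by decide) (by decide) _ _ _ _ e0.2.2 e1.2.2
      e2.2.2 ..

/-- These are the combinations that the three constants of a cubic `C` multiply in the equilibrium
equations. -/
theorem pderiv_two_fieldPoly (a a₁ b₁ c₁ d₁ d₂ d₃ : ℝ) (h₁ h₂ h₃ : Fin 8 → ℝ) (k : Fin 3) :
    let P := fieldPoly a a₁ b₁ c₁ d₁ d₂ d₃ h₁ h₂ h₃
    pderiv k (pderiv k (P k)) = 0 ∧ ∑ l, pderiv k (pderiv l (P l)) = 0 ∧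
      ∑ l, pderiv l (pderiv k (P l)) = 0 ∧ ∑ i, pderiv i (pderiv i (P k)) = 0 := by
  obtain ⟨p1, p2, p3, p4, p5, p6, p7, p8, p9⟩ := pderiv_pderiv_componentPoly (i := 0) (j := 1)
    (k := 2) (by decide) (by decide) (by decide) a b₁ c₁ d₁ h₁
  obtain ⟨q1, q2, q3, q4, q5, q6, q7, q8, q9⟩ := pderiv_pderiv_componentPoly (i := 1) (j := 0)
    (k := 2) (by decide) (by decide) (by decide) (-a) a₁ (-c₁) d₂ h₂
  obtain ⟨r1, r2, r3, r4, r5, r6, r7, r8, r9⟩ := pderiv_pderiv_componentPoly (i := 2) (j := 0)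
    (k := 1) (by decide) (by decide) (by decide) a (-a₁) (-b₁) d₃ h₃
  simp only [Fin.sum_univ_three, fieldPoly]
  fin_cases k <;> refine ⟨?_, ?_, ?_, ?_⟩ <;> simp [*] <;> ring

theorem IsPolynomialField.isUniversalDisplacement {a a₁ b₁ c₁ d₁ d₂ d₃ : ℝ}
    {h₁ h₂ h₃ : Fin 8 → ℝ} {G : Subgroup O3} (hΩ : IsOpen Ω)
    (hP : IsPolynomialField Ω u a a₁ b₁ c₁ d₁ d₂ d₃ h₁ h₂ h₃) (hH : halfTurn ∈ G)
    (hR : thirdTurn ∈ G) (hG : (-1 : O3) ∈ G ∨ ∀ n < 3, h₁ n = 0 ∧ h₂ n = 0 ∧ h₃ n = 0) :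
    IsUniversalDisplacement G Ω u := by
  set P := fieldPoly a a₁ b₁ c₁ d₁ d₂ d₃ h₁ h₂ h₃ with hPdef
  have hcomp : ∀ l, ∀ x ∈ Ω, u x l = polyFun (P l) x := fun l x hx => by
    fin_cases l
    · exact (hP x hx).1
    · exact (hP x hx).2.1
    · exact (hP x hx).2.2
  have hu : ContDiffOn ℝ 4 u Ω :=
    contDiffOn_euclidean.2 fun l => (contDiff_polyFun (P l)).contDiffOn.congr (hcomp l)
  refine ⟨hu, fun L hL x hx => (equilibriumAt_iff L hΩ hu hx).2 fun k => ?_⟩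
  have hH' := hL hH
  have hR' := hL hR
  have d1 : ∀ l p, ∀ y ∈ Ω, pd p (fun z => u z l) y = polyFun (pderiv p (P l)) y :=
    fun l p y hy => by rw [pd_eq_of_eqOn hΩ (hcomp l) hy, pd_polyFun]
  have d2 : ∀ l p q, ∀ y ∈ Ω, pd q (pd p fun z => u z l) y
      = polyFun (pderiv q (pderiv p (P l))) y :=
    fun l p q y hy => by rw [pd_eq_of_eqOn hΩ (d1 l p) hy, pd_polyFun]
  have d3 : ∀ l p q r, ∀ y ∈ Ω, pd r (pd q (pd p fun z => u z l)) y
      = polyFun (pderiv r (pderiv q (pderiv p (P l)))) y :=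
    fun l p q r y hy => by rw [pd_eq_of_eqOn hΩ (d2 l p q) hy, pd_polyFun]
  have d4 : ∀ l p q r s, ∀ y ∈ Ω, pd s (pd r (pd q (pd p fun z => u z l))) y
      = polyFun (pderiv s (pderiv r (pderiv q (pderiv p (P l))))) y :=
    fun l p q r s y hy => by rw [pd_eq_of_eqOn hΩ (d3 l p q r) hy, pd_polyFun]
  -- Each product vanishes separately: either both displacement derivatives in the strain are zero,
  -- or parity kills the component of `A`.
  have hA : ∀ i j k l m n, L.A i j k l m n * pd j (pd i (pd n (strain u l m))) x = 0 := by
    intro i j k l m n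
    rw [pd_pd_pd_strain hΩ hu hx, d4 _ _ _ _ _ x hx, d4 _ _ _ _ _ x hx]
    rcases pderiv_four_fieldPoly a a₁ b₁ c₁ d₁ d₂ d₃ h₁ h₂ h₃ l j i n m with h | h
    · rcases pderiv_four_fieldPoly a a₁ b₁ c₁ d₁ d₂ d₃ h₁ h₂ h₃ m j i n l with h' | h'
      · simp [hPdef, h, h', polyFun]
      · rw [A_eq_zero hH' hR' fun e => by linear_combination h' e, zero_mul]
    · rw [A_eq_zero hH' hR' fun e => by linear_combination h e, zero_mul]
  have hM : (∀ i k l m n, L.M i k l m n * pd i (pd n (strain u l m)) x = 0) ∧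
      ∀ i j k l m, L.M l m i j k * pd j (pd i (strain u l m)) x = 0 := by
    rcases hG with hG | hG
    · simp [M_eq_zero_of_neg_one_mem (hL hG)]
    · constructor
      · intro i k l m n
        rw [pd_pd_strain hΩ hu hx, d3 _ _ _ _ x hx, d3 _ _ _ _ x hx]
        rcases pderiv_three_fieldPoly a a₁ b₁ c₁ d₁ d₂ d₃ hG l i n m with h | h
        · rcases pderiv_three_fieldPoly a a₁ b₁ c₁ d₁ d₂ d₃ hG m i n l with h' | h'
          · simp [hPdef, h, h', polyFun]
          · rw [M_eq_zero hH' hR' fun e => by linear_combination h' e, zero_mul]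
        · rw [M_eq_zero hH' hR' fun e => by linear_combination h e, zero_mul]
      · intro i j k l m
        rw [pd_pd_strain hΩ hu hx, d3 _ _ _ _ x hx, d3 _ _ _ _ x hx]
        rcases pderiv_three_fieldPoly a a₁ b₁ c₁ d₁ d₂ d₃ hG l j i m with h | h
        · rcases pderiv_three_fieldPoly a a₁ b₁ c₁ d₁ d₂ d₃ hG m j i l with h' | h'
          · simp [hPdef, h, h', polyFun]
          · rw [M_eq_zero' hH' hR' fun e => by linear_combination h' e, zero_mul]
        · rw [M_eq_zero' hH' hR' fun e => by linear_combination h e, zero_mul]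
  simp only [hA, hM.1, hM.2, Finset.sum_const_zero, add_zero, sub_zero]
  rw [sum_C_eq hH' hR' k (fun i l m => pd i (strain u l m) x) fun i l m => by
    simp only [pd_strain hΩ hu hx]; ring]
  obtain ⟨s1, s2, s3, s4⟩ := pderiv_two_fieldPoly a a₁ b₁ c₁ d₁ d₂ d₃ h₁ h₂ h₃ k
  have t1 := congrArg (fun p => polyFun p x) s1
  have t2 := congrArg (fun p => polyFun p x) s2
  have t3 := congrArg (fun p => polyFun p x) s3
  have t4 := congrArg (fun p => polyFun p x) s4
  simp only [← hPdef, Fin.sum_univ_three, polyFun, map_add, map_zero] at t1 t2 t3 t4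
  simp only [pd_strain hΩ hu hx, d2 _ _ _ x hx, Fin.sum_univ_three, polyFun, t1]
  linear_combination L.C 0 0 1 1 * t2 + L.C 0 1 0 1 * (t3 + t4)

end PolynomialFields

/-! ### Functions of one variable with vanishing fourth derivative. -/

section CubicFunctions

/-- The cubic function with the given coefficients. -/
def cubicFun (a b c d t : ℝ) : ℝ := a + b * t + c * t ^ 2 + d * t ^ 3

theorem hasDerivAt_cubicFun (a b c d t : ℝ) :
    HasDerivAt (cubicFun a b c d) (cubicFun b (2 * c) (3 * d) 0 t) t := by
  have h := (((hasDerivAt_id t).const_mul b).const_add a).add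
    (((hasDerivAt_pow 2 t).const_mul c).add ((hasDerivAt_pow 3 t).const_mul d))
  refine (h.congr_deriv ?_).congr_of_eventuallyEq (Eventually.of_forall fun y => ?_)
  · simp [cubicFun]; ring
  · simp [cubicFun]; ring

theorem deriv_cubicFun (a b c d : ℝ) :
    deriv (cubicFun a b c d) = cubicFun b (2 * c) (3 * d) 0 :=
  funext fun t => (hasDerivAt_cubicFun a b c d t).deriv

theorem contDiff_cubicFun (a b c d : ℝ) : ContDiff ℝ 4 (cubicFun a b c d) := by
  unfold cubicFun
  fun_prop

theorem iteratedDeriv_two_cubicFun (a b c d : ℝ) :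
    iteratedDeriv 2 (cubicFun a b c d) = cubicFun (2 * c) (2 * (3 * d)) 0 0 := by
  rw [iteratedDeriv_succ', iteratedDeriv_one, deriv_cubicFun, deriv_cubicFun]
  simp

theorem iteratedDeriv_three_cubicFun (a b c d : ℝ) :
    iteratedDeriv 3 (cubicFun a b c d) = cubicFun (2 * (3 * d)) 0 0 0 := by
  rw [iteratedDeriv_succ, iteratedDeriv_two_cubicFun, deriv_cubicFun]
  simp

theorem iteratedDeriv_four_cubicFun (a b c d : ℝ) :
    iteratedDeriv 4 (cubicFun a b c d) = cubicFun 0 0 0 0 := by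
  rw [iteratedDeriv_succ, iteratedDeriv_three_cubicFun, deriv_cubicFun]
  simp

theorem exists_eq_cubicFun_of_deriv {f : ℝ → ℝ} (hf : Differentiable ℝ f) {b c d : ℝ}
    (h : deriv f = cubicFun b c d 0) : ∃ a, f = cubicFun a b (c / 2) (d / 3) := by
  have hP := fun t => hasDerivAt_cubicFun 0 b (c / 2) (d / 3) t
  have hd : ∀ t, HasDerivAt (fun t => f t - cubicFun 0 b (c / 2) (d / 3) t) 0 t := fun t => by
    have := (hf t).hasDerivAt.sub (hP t)
    rwa [h, mul_div_cancel₀ _ two_ne_zero, mul_div_cancel₀ _ three_ne_zero, sub_self] at this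
  refine ⟨f 0, funext fun t => ?_⟩
  have := is_const_of_deriv_eq_zero (fun t => (hd t).differentiableAt) (fun t => (hd t).deriv) t 0
  simp only [cubicFun] at this ⊢
  linarith

theorem exists_eq_cubicFun {f : ℝ → ℝ} (hf : ContDiff ℝ 4 f)
    (h : ∀ t, iteratedDeriv 4 f t = 0) : ∃ a b c d, f = cubicFun a b c d := by
  have hd : ∀ m : ℕ, m < 4 → Differentiable ℝ (iteratedDeriv m f) := fun m hm =>
    hf.differentiable_iteratedDeriv m (by exact_mod_cast hm)
  obtain ⟨d, h3⟩ := exists_eq_cubicFun_of_deriv (b := 0) (c := 0) (d := 0) (hd 3 (by norm_num))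
    (by rw [← iteratedDeriv_succ]; ext t; simp [h, cubicFun])
  obtain ⟨c, h2⟩ := exists_eq_cubicFun_of_deriv (hd 2 (by norm_num))
    (by rw [← iteratedDeriv_succ, h3]; simp only [zero_div]; rfl)
  obtain ⟨b, h1⟩ := exists_eq_cubicFun_of_deriv (hd 1 (by norm_num))
    (by rw [← iteratedDeriv_succ, h2]; simp only [zero_div]; rfl)
  obtain ⟨a, h0⟩ := exists_eq_cubicFun_of_deriv (hf.differentiable (by norm_num))
    (by rw [← iteratedDeriv_one, h1]; simp only [zero_div]; rfl)
  exact ⟨_, _, _, _, h0⟩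

end CubicFunctions

/-! ### Splitting conditions and harmonic polynomials. -/

section Splitting

open InnerProductSpace

theorem harmonicOnNhd_polyFun_iff {n : ℕ} (p : MvPolynomial (Fin n) ℝ) :
    HarmonicOnNhd (polyFun p) univ ↔ ∀ x, polyFun (∑ i, pderiv i (pderiv i p)) x = 0 := by
  simp only [← laplacian_polyFun]
  refine ⟨fun h x => (h x (mem_univ x)).2.self_of_nhds, fun h x _ =>
    ⟨(contDiff_polyFun p).contDiffAt, Eventually.of_forall h⟩⟩

theorem exists_harmonicPoly_of_splits {g : E2 → ℝ} {p q r w : ℝ → ℝ}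
    (hg : HarmonicOnNhd g univ) (hs : Splits g p q r w) :
    ∃ h : Fin 8 → ℝ, (LowerConditions p q r w → ∀ n < 3, h n = 0) ∧
      ∀ s t, g !₂[s, t] = harmonicPoly h s t := by
  obtain ⟨hp, hq, hr, hw, hsum, hrw, hpq⟩ := hs
  -- The conditions are affine in the free variable, so its values `0` and `1` separate them; all
  -- four functions are cubic.
  have hr4 : ∀ s, iteratedDeriv 4 r s = 0 := fun s => by simpa using hrw s 0
  have hw4 : ∀ s, iteratedDeriv 4 w s = 0 := fun s => by simpa [hr4] using hrw s 1
  have hp4 : ∀ t, iteratedDeriv 4 p t = 0 := fun t => by simpa using hpq 0 t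
  have hq4 : ∀ t, iteratedDeriv 4 q t = 0 := fun t => by simpa [hp4] using hpq 1 t
  obtain ⟨p0, p1, p2, p3, rfl⟩ := exists_eq_cubicFun hp hp4
  obtain ⟨q0, q1, q2, q3, rfl⟩ := exists_eq_cubicFun hq hq4
  obtain ⟨r0, r1, r2, r3, rfl⟩ := exists_eq_cubicFun hr hr4
  obtain ⟨w0, w1, w2, w3, rfl⟩ := exists_eq_cubicFun hw hw4
  set P : MvPolynomial (Fin 2) ℝ := (C p0 + C p1 * X 1 + C p2 * X 1 ^ 2 + C p3 * X 1 ^ 3)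
    + X 0 * (C q0 + C q1 * X 1 + C q2 * X 1 ^ 2 + C q3 * X 1 ^ 3)
    + (C r0 + C r1 * X 0 + C r2 * X 0 ^ 2 + C r3 * X 0 ^ 3)
    + X 1 * (C w0 + C w1 * X 0 + C w2 * X 0 ^ 2 + C w3 * X 0 ^ 3) with hP
  have hgP : g = polyFun P := by
    ext x
    have hx : x = !₂[x 0, x 1] := by ext i; fin_cases i <;> rfl
    conv_lhs => rw [hx]
    rw [hsum]
    simp [hP, polyFun, cubicFun]
  rw [hgP, harmonicOnNhd_polyFun_iff] at hg
  have hlap : ∀ s t : ℝ, 2 * p2 + 6 * p3 * t + s * (2 * q2 + 6 * q3 * t) + 2 * r2 + 6 * r3 * s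
      + t * (2 * w2 + 6 * w3 * s) = 0 := fun s t => by
    have h := hg !₂[s, t]
    simp [hP, polyFun] at h
    linarith
  -- The Laplacian lies in the span of `1, s, t, st`, so four points give all its coefficients.
  have e0 := hlap 0 0
  have e1 := hlap 1 0
  have e2 := hlap 0 1
  have e3 := hlap 1 1
  -- The entries match the coefficients of `s³t`, `s³`, `t³`, `s²`, `st`, `s`, `t` and `1`. The
  -- minus sign reflects the term `-t³` in `harmonicPoly`.
  refine ⟨![w3, r3, -p3, r2, q1 + w1, q0 + r1, p1 + w0, p0 + r0], fun hlow => ?_, fun s t => ?_⟩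
  · obtain ⟨-, -, h1, h2⟩ := hlow
    simp only [iteratedDeriv_three_cubicFun, cubicFun] at h1 h2
    have f1 := h1 0 0
    have f2 := h1 0 1
    have f3 := h2 0 0
    intro n hn
    obtain rfl | rfl | rfl : n = 0 ∨ n = 1 ∨ n = 2 := by decide +revert
    · simp; linarith
    · simp; linarith
    · simp; linarith
  · rw [hsum]
    have k1 : w2 = -3 * p3 := by linarith
    have k2 : q2 = -3 * r3 := by linarith
    have k3 : q3 = -w3 := by linarith
    have k4 : p2 = -r2 := by linarith
    simp [cubicFun, harmonicPoly, k1, k2, k3, k4]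
    ring

theorem exists_splits_harmonicPoly (h : Fin 8 → ℝ) :
    ∃ (g : E2 → ℝ) (p q r w : ℝ → ℝ), HarmonicOnNhd g univ ∧ Splits g p q r w ∧
      ((∀ n < 3, h n = 0) → LowerConditions p q r w) ∧
      ∀ s t, g !₂[s, t] = harmonicPoly h s t := by
  -- The splitting is not unique. Here the terms of degree at most one in `s` go to the first two
  -- functions, and those with `s²` or `s³` to the last two.
  refine ⟨polyFun (harmonicPoly (fun n => C (h n)) (X 0) (X 1)),
    cubicFun (h 7) (h 6) (-h 3) (-h 2), cubicFun (h 5) (h 4) (-3 * h 1) (-h 0),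
    cubicFun 0 0 (h 3) (h 1), cubicFun 0 0 (3 * h 2) (h 0),
    (harmonicOnNhd_polyFun_iff _).2 fun x => ?_,
    ⟨contDiff_cubicFun _ _ _ _, contDiff_cubicFun _ _ _ _, contDiff_cubicFun _ _ _ _,
      contDiff_cubicFun _ _ _ _, fun s t => ?_, fun s t => ?_, fun s t => ?_⟩,
    fun hn => ⟨fun s => ?_, fun t => ?_, fun s t => ?_, fun s t => ?_⟩, fun s t => ?_⟩
  · simp [harmonicPoly, polyFun]
    ring
  · simp [harmonicPoly, polyFun, cubicFun]
    ring
  · simp [iteratedDeriv_four_cubicFun, cubicFun]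
  · simp [iteratedDeriv_four_cubicFun, cubicFun]
  · simp [iteratedDeriv_two_cubicFun, cubicFun, hn 0, hn 2]
  · simp [iteratedDeriv_two_cubicFun, cubicFun, hn 0, hn 1]
  · simp [iteratedDeriv_three_cubicFun, cubicFun, hn 0, hn 1]
  · simp [iteratedDeriv_three_cubicFun, cubicFun, hn 0, hn 2]
  · simp [harmonicPoly, polyFun]

theorem isPolynomialField_of_hasCubicForm {Ω : Set E3} {u : E3 → E3} {a a₁ b₁ c₁ d₁ d₂ d₃ : ℝ}
    {g₁ g₂ g₃ : E2 → ℝ} {h₁ h₂ h₃ : Fin 8 → ℝ}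
    (hu : HasCubicForm Ω u a a₁ b₁ c₁ d₁ d₂ d₃ g₁ g₂ g₃)
    (e1 : ∀ s t, g₁ !₂[s, t] = harmonicPoly h₁ s t) (e2 : ∀ s t, g₂ !₂[s, t] = harmonicPoly h₂ s t)
    (e3 : ∀ s t, g₃ !₂[s, t] = harmonicPoly h₃ s t) :
    IsPolynomialField Ω u a a₁ b₁ c₁ d₁ d₂ d₃ h₁ h₂ h₃ := by
  intro x hx
  obtain ⟨k1, k2, k3⟩ := hu.2.2.2 x hx
  simp only [polyFun_componentPoly, k1, k2, k3, e1, e2, e3]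
  refine ⟨trivial, ?_, ?_⟩ <;> ring

theorem IsPolynomialField.hasCubicForm {Ω : Set E3} {u : E3 → E3} {a a₁ b₁ c₁ d₁ d₂ d₃ : ℝ}
    {g₁ g₂ g₃ : E2 → ℝ} {h₁ h₂ h₃ : Fin 8 → ℝ}
    (hu : IsPolynomialField Ω u a a₁ b₁ c₁ d₁ d₂ d₃ h₁ h₂ h₃)
    (hg₁ : HarmonicOnNhd g₁ univ) (hg₂ : HarmonicOnNhd g₂ univ) (hg₃ : HarmonicOnNhd g₃ univ)
    (e1 : ∀ s t, g₁ !₂[s, t] = harmonicPoly h₁ s t) (e2 : ∀ s t, g₂ !₂[s, t] = harmonicPoly h₂ s t)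
    (e3 : ∀ s t, g₃ !₂[s, t] = harmonicPoly h₃ s t) :
    HasCubicForm Ω u a a₁ b₁ c₁ d₁ d₂ d₃ g₁ g₂ g₃ := by
  refine ⟨hg₁, hg₂, hg₃, fun x hx => ?_⟩
  obtain ⟨k1, k2, k3⟩ := hu x hx
  simp only [polyFun_componentPoly] at k1 k2 k3
  simp only [k1, k2, k3, e1, e2, e3]
  refine ⟨trivial, ?_, ?_⟩ <;> ring

end Splitting

/-! ### Group generators and assembly of the two equivalences. -/

theorem halfTurn_mem_groupT : halfTurn ∈ groupT := Subgroup.subset_closure (by simp)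

theorem thirdTurn_mem_groupT : thirdTurn ∈ groupT := Subgroup.subset_closure (by simp)

theorem groupT_le_groupTZ2c : groupT ≤ groupTZ2c := le_sup_left

theorem neg_one_mem_groupTZ2c : (-1 : O3) ∈ groupTZ2c :=
  (le_sup_right : _ ≤ groupTZ2c) (Subgroup.subset_closure (by simp))

end StrainGradient

end

theorem mainTheorem11 (Ω : Set StrainGradient.E3) (hΩ : IsOpen Ω) (hconn : IsConnected Ω)
    (u : StrainGradient.E3 → StrainGradient.E3) :
    (StrainGradient.IsUniversalDisplacement StrainGradient.groupT Ω u ↔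
      ∃ (a a₁ b₁ c₁ d₁ d₂ d₃ : ℝ) (g₁ g₂ g₃ : StrainGradient.E2 → ℝ)
        (f₁ f₂ f₃ f₄ f₅ f₆ f₇ f₈ f₉ f₁₀ f₁₁ f₁₂ : ℝ → ℝ),
        StrainGradient.HasCubicForm Ω u a a₁ b₁ c₁ d₁ d₂ d₃ g₁ g₂ g₃ ∧
        StrainGradient.Splits g₁ f₁ f₂ f₃ f₄ ∧
        StrainGradient.Splits g₂ f₅ f₆ f₇ f₈ ∧
        StrainGradient.Splits g₃ f₉ f₁₀ f₁₁ f₁₂ ∧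
        StrainGradient.LowerConditions f₁ f₂ f₃ f₄ ∧
        StrainGradient.LowerConditions f₅ f₆ f₇ f₈ ∧
        StrainGradient.LowerConditions f₉ f₁₀ f₁₁ f₁₂) ∧
    (StrainGradient.IsUniversalDisplacement StrainGradient.groupTZ2c Ω u ↔
      ∃ (a a₁ b₁ c₁ d₁ d₂ d₃ : ℝ) (g₁ g₂ g₃ : StrainGradient.E2 → ℝ)
        (f₁ f₂ f₃ f₄ f₅ f₆ f₇ f₈ f₉ f₁₀ f₁₁ f₁₂ : ℝ → ℝ),
        StrainGradient.HasCubicForm Ω u a a₁ b₁ c₁ d₁ d₂ d₃ g₁ g₂ g₃ ∧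
        StrainGradient.Splits g₁ f₁ f₂ f₃ f₄ ∧
        StrainGradient.Splits g₂ f₅ f₆ f₇ f₈ ∧
        StrainGradient.Splits g₃ f₉ f₁₀ f₁₁ f₁₂) := by
  refine ⟨⟨fun hu => ?_, ?_⟩, fun hu => ?_, ?_⟩
  · obtain ⟨a, a₁, b₁, c₁, d₁, d₂, d₃, h₁, h₂, h₃, hlow, hP⟩ :=
      hu.exists_isPolynomialField hΩ hconn.isPreconnected
        (StrainGradient.groupT_le.trans (StrainGradient.signedCyclic_mono bot_le))
    replace hlow := hlow StrainGradient.groupT_le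
    obtain ⟨g₁, f₁, f₂, f₃, f₄, hg₁, hs₁, hl₁, e₁⟩ := StrainGradient.exists_splits_harmonicPoly h₁
    obtain ⟨g₂, f₅, f₆, f₇, f₈, hg₂, hs₂, hl₂, e₂⟩ := StrainGradient.exists_splits_harmonicPoly h₂
    obtain ⟨g₃, f₉, f₁₀, f₁₁, f₁₂, hg₃, hs₃, hl₃, e₃⟩ := StrainGradient.exists_splits_harmonicPoly h₃
    exact ⟨a, a₁, b₁, c₁, d₁, d₂, d₃, g₁, g₂, g₃, f₁, f₂, f₃, f₄, f₅, f₆, f₇, f₈, f₉, f₁₀, f₁₁, f₁₂,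
      hP.hasCubicForm hg₁ hg₂ hg₃ e₁ e₂ e₃, hs₁, hs₂, hs₃, hl₁ fun n hn => (hlow n hn).1,
      hl₂ fun n hn => (hlow n hn).2.1, hl₃ fun n hn => (hlow n hn).2.2⟩
  · rintro ⟨a, a₁, b₁, c₁, d₁, d₂, d₃, g₁, g₂, g₃, f₁, f₂, f₃, f₄, f₅, f₆, f₇, f₈, f₉, f₁₀, f₁₁, f₁₂,
      hform, hs₁, hs₂, hs₃, hl₁, hl₂, hl₃⟩
    obtain ⟨h₁, z₁, e₁⟩ := StrainGradient.exists_harmonicPoly_of_splits hform.1 hs₁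
    obtain ⟨h₂, z₂, e₂⟩ := StrainGradient.exists_harmonicPoly_of_splits hform.2.1 hs₂
    obtain ⟨h₃, z₃, e₃⟩ := StrainGradient.exists_harmonicPoly_of_splits hform.2.2.1 hs₃
    exact (StrainGradient.isPolynomialField_of_hasCubicForm hform e₁ e₂ e₃).isUniversalDisplacement hΩ
      StrainGradient.halfTurn_mem_groupT StrainGradient.thirdTurn_mem_groupT
      (Or.inr fun n hn => ⟨z₁ hl₁ n hn, z₂ hl₂ n hn, z₃ hl₃ n hn⟩)
  · obtain ⟨a, a₁, b₁, c₁, d₁, d₂, d₃, h₁, h₂, h₃, -, hP⟩ :=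
      hu.exists_isPolynomialField hΩ hconn.isPreconnected StrainGradient.groupTZ2c_le
    obtain ⟨g₁, f₁, f₂, f₃, f₄, hg₁, hs₁, -, e₁⟩ := StrainGradient.exists_splits_harmonicPoly h₁
    obtain ⟨g₂, f₅, f₆, f₇, f₈, hg₂, hs₂, -, e₂⟩ := StrainGradient.exists_splits_harmonicPoly h₂
    obtain ⟨g₃, f₉, f₁₀, f₁₁, f₁₂, hg₃, hs₃, -, e₃⟩ := StrainGradient.exists_splits_harmonicPoly h₃
    exact ⟨a, a₁, b₁, c₁, d₁, d₂, d₃, g₁, g₂, g₃, f₁, f₂, f₃, f₄, f₅, f₆, f₇, f₈, f₉, f₁₀, f₁₁, f₁₂,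
      hP.hasCubicForm hg₁ hg₂ hg₃ e₁ e₂ e₃, hs₁, hs₂, hs₃⟩
  · rintro ⟨a, a₁, b₁, c₁, d₁, d₂, d₃, g₁, g₂, g₃, f₁, f₂, f₃, f₄, f₅, f₆, f₇, f₈, f₉, f₁₀, f₁₁, f₁₂,
      hform, hs₁, hs₂, hs₃⟩
    obtain ⟨h₁, -, e₁⟩ := StrainGradient.exists_harmonicPoly_of_splits hform.1 hs₁
    obtain ⟨h₂, -, e₂⟩ := StrainGradient.exists_harmonicPoly_of_splits hform.2.1 hs₂
    obtain ⟨h₃, -, e₃⟩ := StrainGradient.exists_harmonicPoly_of_splits hform.2.2.1 hs₃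
    exact (StrainGradient.isPolynomialField_of_hasCubicForm hform e₁ e₂ e₃).isUniversalDisplacement hΩ
      (StrainGradient.groupT_le_groupTZ2c StrainGradient.halfTurn_mem_groupT) (StrainGradient.groupT_le_groupTZ2c StrainGradient.thirdTurn_mem_groupT)
      (Or.inl StrainGradient.neg_one_mem_groupTZ2c)
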